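/- Conventions. For an algebraically closed field $K$, a \emph{CM-curve} in $\mathbb P^n_K$ is a finite morphism $i\colon X\to\mathbb P^n_K$ such that $X$ is Cohen--Macaulay of pure dimension one and $i$ is, outside a finite closed set of points, an isomorphism onto its schematic image. A point $P$ of the schematic image $D$ of a CM-curve $i\colon X\to\mathbb P^n_K$ is a \emph{plain double point} if the $\mathcal O_{D,P}$-module $(i_*\mathcal O_X/\mathcal O_D)_P$ has length one. A \emph{family of CM-curves} in $\mathbb P^n$ over a ring $R$ is a finite morphism $i_R\colon X_R\to\mathbb P^n_R$ such that $X_R$ is flat over $R$ and, for every algebraically closed field $K$ and every morphism $\operatorname{Spec}K\to\operatorname{Spec}R$, the base change $X_K\to\mathbb P^n_K$ is a CM-curve. Proposition. Let $R$ be a Noetherian local ring whose residue field $\kappa$ is algebraically closed, and let $i_R\colon X_R\to\mathbb P^2_R$ be a family of CM-curves over $R$. Let $i\colon X\to\mathbb P^2_\kappa$ be its closed fibre, let $P\in\mathbb P^2_\kappa$ be a plain double point of $i$, and let $\xi\in\mathbb P^2_R$ be the image of $P$ under the natural inclusion $\mathbb P^2_\kappa\subseteq\mathbb P^2_R$. Then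 $\xi$ lies on the schematic image $D_R\subseteq\mathbb P^2_R$ of $X_R$, and there are elements $g,f,s,t\in\mathcal O_{\mathbb P^2_R,\xi}$ and an exact sequence of $\mathcal O_{\mathbb P^2_R,\xi}$-modules $$\mathcal O_{\mathbb P^2_R,\xi}^{\oplus 2}\xrightarrow{\begin{pmatrix} g&f\\ s&t\end{pmatrix}}\mathcal O_{\mathbb P^2_R,\xi}^{\oplus 2}\longrightarrow (i_{R*}\mathcal O_{X_R})_\xi\longrightarrow 0$$ such that $s$ and $t$ lie in the maximal ideal of $\mathcal O_{\mathbb P^2_R,\xi}$, and $g$ and $f$ lie in the ideal $\mathfrak n_R=(s,t)$. Furthermore, $\mathfrak n_R$ contains the ideal of $D_R$ in $\mathcal O_{\mathbb P^2_R,\xi}$, and its image in $\mathcal O_{D_R,\xi}$ is the annihilator (conductor) ideal $\operatorname{Ann}_{\mathcal O_{D_R,\xi}}\big((i_{R*}\mathcal O_{X_R}/\mathcal O_{D_R})_\xi\big)$. -/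

import Mathlib

open AlgebraicGeometry CategoryTheory CategoryTheory.Limits
open scoped TopCat

universe u

noncomputable section

namespace CMCurve

attribute [local instance] MvPolynomial.gradedAlgebra

/-- Projective `n`-space `ℙⁿ_R = Proj R[x₀, …, xₙ]`. -/
abbrev ProjSpace (n : ℕ) (R : Type u) [CommRing R] : Scheme.{u} :=
  Proj (MvPolynomial.homogeneousSubmodule (Fin (n + 1)) R)

/-- The structure morphism `ℙⁿ_R ⟶ Spec R`. -/
def ProjSpace.toSpec (n : ℕ) (R : Type u) [CommRing R] :
    ProjSpace n R ⟶ Spec (CommRingCat.of R) :=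
  Proj.toSpecZero (MvPolynomial.homogeneousSubmodule (Fin (n + 1)) R) ≫
    Spec.map (CommRingCat.ofHom
      (algebraMap R (MvPolynomial.homogeneousSubmodule (Fin (n + 1)) R 0)))

/-- A Cohen-Macaulay local ring: a Noetherian local ring `A` whose maximal ideal contains an
`A`-regular sequence of length `dim A` (that is, `depth A = dim A`). -/
def IsCohenMacaulayLocalRing (A : Type u) [CommRing A] [IsLocalRing A] : Prop :=
  IsNoetherianRing A ∧ ∃ rs : List A,
    (∀ r ∈ rs, r ∈ IsLocalRing.maximalIdeal A) ∧ RingTheory.Sequence.IsRegular A rs ∧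
      (rs.length : WithBot ℕ∞) = ringKrullDim A

/-- A Cohen-Macaulay scheme: locally Noetherian with Cohen-Macaulay local rings. -/
def IsCohenMacaulayScheme (X : Scheme.{u}) : Prop :=
  IsLocallyNoetherian X ∧ ∀ x : X, IsCohenMacaulayLocalRing (X.presheaf.stalk x)

/-- Every irreducible component has dimension one. -/
def IsPureDimOne (X : Scheme.{u}) : Prop :=
  ∀ Z ∈ irreducibleComponents X, topologicalKrullDim Z = 1

/-- The morphism `i : X ⟶ Y` is a CM-curve in `Y` (below `Y` is a projective space over an
algebraically closed field): `i` is finite, `X` is Cohen-Macaulay of pure dimension one, and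
`i` is an isomorphism onto its schematic image outside a finite closed set of points of the
image. -/
structure IsCMCurve {X Y : Scheme.{u}} (i : X ⟶ Y) : Prop where
  finite : IsFinite i
  cohenMacaulay : IsCohenMacaulayScheme X
  pureDimOne : IsPureDimOne X
  isoOffFinite : ∃ U : i.image.Opens, ((U : Set i.image)ᶜ).Finite ∧ IsIso (i.toImage ∣_ U)

/-- For `x : Spec K ⟶ Spec R`, the base change `ℙⁿ_K = ℙⁿ_R ×_R K`. -/
abbrev fibreSpace (n : ℕ) {R K : Type u} [CommRing R] [CommRing K]
    (x : Spec (CommRingCat.of K) ⟶ Spec (CommRingCat.of R)) : Scheme.{u} :=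
  pullback (ProjSpace.toSpec n R) x

/-- The natural morphism `ℙⁿ_K ⟶ ℙⁿ_R`. -/
abbrev fibreSpaceMap (n : ℕ) {R K : Type u} [CommRing R] [CommRing K]
    (x : Spec (CommRingCat.of K) ⟶ Spec (CommRingCat.of R)) : fibreSpace n x ⟶ ProjSpace n R :=
  pullback.fst (ProjSpace.toSpec n R) x

/-- The fibre `i_K : X_K ⟶ ℙⁿ_K` of `i : X ⟶ ℙⁿ_R` along `x : Spec K ⟶ Spec R`, with
`X_K = X ×_R K` written as `X ×_{ℙⁿ_R} ℙⁿ_K`. -/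
abbrev fibreMap {n : ℕ} {R K : Type u} [CommRing R] [CommRing K] {X : Scheme.{u}}
    (i : X ⟶ ProjSpace n R) (x : Spec (CommRingCat.of K) ⟶ Spec (CommRingCat.of R)) :
    pullback i (fibreSpaceMap n x) ⟶ fibreSpace n x :=
  pullback.snd i (fibreSpaceMap n x)

/-- A family of CM-curves in `ℙⁿ` over `Spec R`: a finite morphism `i : X ⟶ ℙⁿ_R` with `X` flat
over `R` whose fibres over all geometric points of `Spec R` are CM-curves. -/
structure IsCMFamily {n : ℕ} {R : Type u} [CommRing R] {X : Scheme.{u}}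
    (i : X ⟶ ProjSpace n R) : Prop where
  finite : IsFinite i
  flat : Flat (i ≫ ProjSpace.toSpec n R)
  geometricFibre : ∀ (K : Type u) [Field K] [IsAlgClosed K]
    (x : Spec (CommRingCat.of K) ⟶ Spec (CommRingCat.of R)), IsCMCurve (fibreMap i x)

/-- The closed point `Spec κ ⟶ Spec R` of a local ring `R` with residue field `κ`. -/
abbrev closedPt (R : Type u) [CommRing R] [IsLocalRing R] :
    Spec (CommRingCat.of (IsLocalRing.ResidueField R)) ⟶ Spec (CommRingCat.of R) :=
  Spec.map (CommRingCat.ofHom (IsLocalRing.residue R))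

/-- The stalk `(i_* 𝒪_X)_y`. -/
def PushforwardStalk {X Y : Scheme.{u}} (i : X ⟶ Y) (y : Y) : Type u :=
  ((i.base _* X.presheaf).stalk y : CommRingCat.{u})

instance {X Y : Scheme.{u}} (i : X ⟶ Y) (y : Y) : CommRing (PushforwardStalk i y) :=
  inferInstanceAs (CommRing ((i.base _* X.presheaf).stalk y : CommRingCat.{u}))

/-- The `𝒪_{Y,y}`-algebra structure on `(i_* 𝒪_X)_y`, induced by `𝒪_Y ⟶ i_* 𝒪_X`. -/
instance {X Y : Scheme.{u}} (i : X ⟶ Y) (y : Y) :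
    Algebra (Y.presheaf.stalk y) (PushforwardStalk i y) :=
  ((TopCat.Presheaf.stalkFunctor CommRingCat.{u} y).map i.c).hom.toAlgebra

/-- The stalk at `η ∈ D` of the sheaf `𝒦 = i_* 𝒪_X / 𝒪_D`, where `D` is the schematic image of
`i : X ⟶ Y`, as a module over `𝒪_{D,η}`. -/
abbrev CokernelStalk {X Y : Scheme.{u}} (i : X ⟶ Y) (η : i.image) : Type u :=
  PushforwardStalk i.toImage η ⧸
    LinearMap.range (Algebra.linearMap (i.image.presheaf.stalk η) (PushforwardStalk i.toImage η))

/-- `P` is a point of the schematic image `D` of `i` and `𝒦_P` has length one over `𝒪_{D,P}`. -/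
def IsPlainDoublePoint {X Y : Scheme.{u}} (i : X ⟶ Y) (P : Y) : Prop :=
  ∃ η : i.image, i.imageι η = P ∧
    Module.length (i.image.presheaf.stalk η) (CokernelStalk i η) = 1

end CMCurve

end

/-!
Let `A` be the local ring of `ℙ²_R` at `ξ`, `B` the stalk of the direct image of `𝒪_X`, and `A₀`,
`B₀` their analogues on the fibre. A plain double point means that the cokernel of `A₀ → B₀` is a
simple module, so `B₀` is generated over `A₀` by `1` and some `v₀`. If `P` is a closed point, then
`A₀` is regular of dimension two and, the fibre being Cohen-Macaulay of pure dimension one, `B₀` has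
depth one: modulo a nonzerodivisor `z ∈ 𝔪 ∖ 𝔪²` on `B₀` the ring `A₀` becomes a principal ideal
ring, over which submodules of free modules of rank two have two generators, and by Nakayama's lemma
so do the relations between `1` and `v₀`. At the other points `A₀` itself is a principal ideal ring.

Since `B` is flat over `R`, reduction to the fibre maps the relations between `1` and a lift `v` of
`v₀` onto those between `1` and `v₀`, with kernel `I` times the relations, `I` being the ideal of
the fibre. By Nakayama's lemma `1` and `v` generate `B`, and two relations `(g, s)` and `(f, t)`
generate all of them. The coefficients of `v` in the relations `a + b v = 0` are exactly the `b`
with `b B ⊆ A`, so `(s, t)` is the conductor; it is proper because `A → B` is not surjective, and it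
contains `g = -s v` and `f = -t v`, because `a = -b v` gives `a B ⊆ b B ⊆ A`.
-/

noncomputable section

namespace CMCurve

open IsLocalRing

section Generators

lemma exists_span_range_eq_of_spanFinrank_le {A M : Type*} [CommRing A] [AddCommGroup M]
    [Module A M] {N : Submodule A M} (hN : N.FG) {n : ℕ} (hn : N.spanFinrank ≤ n) :
    ∃ v : Fin n → M, Submodule.span A (Set.range v) = N := by
  obtain ⟨s, hs, rfl⟩ := hN.exists_span_finset_card_eq_spanFinrank
  obtain ⟨e⟩ : Nonempty (s ↪ Fin n) :=
    Function.Embedding.nonempty_of_card_le (by simpa [hs] using hn)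
  refine ⟨Function.extend e Subtype.val 0, le_antisymm (Submodule.span_le.2 ?_) ?_⟩
  · refine (Set.range_extend_subset _ _ _).trans (Set.union_subset ?_ ?_)
    · simp
    · rintro _ ⟨k, -, rfl⟩
      exact zero_mem _
  · refine Submodule.span_mono fun x hx ↦ ⟨e ⟨x, hx⟩, e.injective.extend_apply _ _ _⟩

lemma spanFinrank_span_range_le {A M : Type*} [Semiring A] [AddCommMonoid M] [Module A M] {n : ℕ}
    (v : Fin n → M) : (Submodule.span A (Set.range v)).spanFinrank ≤ n := by
  refine (Submodule.spanFinrank_span_le_ncard_of_finite (Set.finite_range v)).trans ?_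
  simpa using Set.ncard_image_le (f := v) Set.finite_univ

section Nakayama

variable {A A' M M' : Type*} [CommRing A] [CommRing A'] [AddCommGroup M] [AddCommGroup M']
  [Module A M] [Module A' M'] {σ : A →+* A'} [RingHomSurjective σ]

lemma le_of_map_le_map_of_inf_ker_le_smul (f : M →ₛₗ[σ] M') {J : Ideal A}
    (hJ : J ≤ Ideal.jacobson ⊥) {N P : Submodule A M} (hN : N.FG) (hPN : P ≤ N)
    (hker : N ⊓ LinearMap.ker f ≤ J • N) (hmap : N.map f ≤ P.map f) : N ≤ P := by
  refine Submodule.le_of_le_smul_of_le_jacobson_bot hN hJ fun x hx ↦ ?_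
  obtain ⟨y, hy, hyx⟩ := hmap (Submodule.mem_map_of_mem hx)
  rw [← add_sub_cancel y x]
  exact Submodule.add_mem_sup hy (hker ⟨N.sub_mem hx (hPN hy), by simp [hyx]⟩)

lemma exists_span_range_eq_of_span_range_eq_map {ι : Type*} (f : M →ₛₗ[σ] M') {J : Ideal A}
    (hJ : J ≤ Ideal.jacobson ⊥) {N : Submodule A M} (hN : N.FG)
    (hker : N ⊓ LinearMap.ker f ≤ J • N) {v' : ι → M'}
    (hv' : Submodule.span A' (Set.range v') = N.map f) :
    ∃ v : ι → M, Submodule.span A (Set.range v) = N := by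
  have hlift (k : ι) : ∃ x ∈ N, f x = v' k :=
    Submodule.mem_map.1 (hv' ▸ Submodule.subset_span (Set.mem_range_self k))
  choose v hvN hv using hlift
  have hle : Submodule.span A (Set.range v) ≤ N :=
    Submodule.span_le.2 (Set.range_subset_iff.2 hvN)
  refine ⟨v, hle.antisymm (le_of_map_le_map_of_inf_ker_le_smul f hJ hN hle hker ?_)⟩
  rw [Submodule.map_span, ← Set.range_comp, ← hv']
  exact (congr_arg (fun w ↦ Submodule.span A' (Set.range w)) (funext hv)).ge

end Nakayama

/-- The map `(ι → A) → (ι → A')` applying `φ : A → A'` to each coordinate, as a `φ`-semilinear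
map. -/
def mapCoordinates {A A' : Type*} [CommRing A] [CommRing A'] (φ : A →+* A') (ι : Type*) :
    (ι → A) →ₛₗ[φ] (ι → A') where
  toFun x k := φ (x k)
  map_add' x y := funext fun k ↦ map_add φ (x k) (y k)
  map_smul' a x := funext fun k ↦ map_mul φ a (x k)

@[simp]
lemma mapCoordinates_apply {A A' : Type*} [CommRing A] [CommRing A'] (φ : A →+* A') {ι : Type*}
    (x : ι → A) (k : ι) : mapCoordinates φ ι x k = φ (x k) :=
  rfl

lemma mapCoordinates_surjective {A A' : Type*} [CommRing A] [CommRing A'] (φ : A →+* A')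
    [RingHomSurjective φ] (ι : Type*) : Function.Surjective (mapCoordinates φ ι) :=
  (RingHomSurjective.is_surjective (σ := φ)).comp_left

lemma ker_mapCoordinates {A A' ι : Type*} [CommRing A] [CommRing A'] [Finite ι] (φ : A →+* A') :
    LinearMap.ker (mapCoordinates φ ι) = RingHom.ker φ • ⊤ := by
  have := Fintype.ofFinite ι
  classical
  refine le_antisymm (fun x hx ↦ ?_) (Submodule.smul_le.2 fun a ha x _ ↦ ?_)
  · rw [← Finset.univ_sum_single x]
    refine Submodule.sum_mem _ fun k _ ↦ ?_
    rw [show Pi.single k (x k) = x k • Pi.single k (1 : A) by simp [← Pi.single_smul]]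
    exact Submodule.smul_mem_smul (congr_fun hx k) trivial
  · ext k
    simp [RingHom.mem_ker.1 ha]

lemma isPrincipalIdealRing_of_spanFinrank_maximalIdeal_le_one {A : Type*} [CommRing A]
    [IsLocalRing A] [IsNoetherianRing A] (hA : (maximalIdeal A).spanFinrank ≤ 1) :
    IsPrincipalIdealRing A := by
  obtain ⟨w, hw⟩ : ∃ w, Ideal.span {w} = maximalIdeal A := by
    obtain ⟨v, hv⟩ := exists_span_range_eq_of_spanFinrank_le (IsNoetherian.noetherian _) hA
    exact ⟨v 0, by rw [← hv, Set.range_unique]; rfl⟩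
  refine IsPrincipalIdealRing.of_prime fun P hP ↦ ?_
  by_cases hwP : w ∈ P
  · exact ⟨w, le_antisymm (hw.ge.trans' (le_maximalIdeal hP.ne_top))
      ((Submodule.span_singleton_le_iff_mem _ _).2 hwP)⟩
  · suffices P = ⊥ from this ▸ bot_isPrincipal
    refine Submodule.eq_bot_of_le_smul_of_le_jacobson_bot (maximalIdeal A) P
      (IsNoetherian.noetherian P) (fun p hp ↦ ?_) (maximalIdeal_le_jacobson _)
    obtain ⟨c, rfl⟩ := Submodule.mem_span_singleton.1 (hw.ge (le_maximalIdeal hP.ne_top hp))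
    rw [smul_eq_mul] at hp
    rw [show c • w = w • c from mul_comm c w]
    exact Submodule.smul_mem_smul (hw.le (Submodule.mem_span_singleton_self w))
      ((hP.mem_or_mem hp).resolve_right hwP)

lemma exists_span_range_eq_of_isPrincipalIdealRing {A : Type*} [CommRing A]
    [IsPrincipalIdealRing A] {n : ℕ} (N : Submodule A (Fin n → A)) :
    ∃ v : Fin n → Fin n → A, Submodule.span A (Set.range v) = N := by
  induction n with
  | zero => exact ⟨0, Subsingleton.elim _ _⟩
  | succ n ih =>
    let tail : (Fin n → A) →ₗ[A] (Fin (n + 1) → A) := LinearMap.pi (Fin.cons 0 LinearMap.proj)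
    obtain ⟨v, hv⟩ := ih (N.comap tail)
    obtain ⟨c, hc⟩ := IsPrincipalIdealRing.principal (N.map (LinearMap.proj 0))
    obtain ⟨x, hxN, rfl⟩ : c ∈ N.map (LinearMap.proj 0) :=
      hc ▸ Submodule.mem_span_singleton_self c
    refine ⟨Fin.cons x (tail ∘ v), le_antisymm ?_ fun y hy ↦ ?_⟩
    · rw [Submodule.span_le, Fin.range_cons, Set.insert_subset_iff, Set.range_subset_iff]
      exact ⟨hxN, fun k ↦ hv.le (Submodule.subset_span (Set.mem_range_self k))⟩
    · obtain ⟨a, ha⟩ := Submodule.mem_span_singleton.1 (hc ▸ Submodule.mem_map_of_mem hy)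
      have htail : tail (Fin.tail (y - a • x)) = y - a • x := by
        ext k
        refine Fin.cases ?_ (fun k ↦ rfl) k
        exact (sub_eq_zero.2 ha.symm).symm
      rw [Fin.range_cons, Submodule.mem_span_insert, Set.range_comp, ← Submodule.map_span, hv]
      refine ⟨a, y - a • x, ⟨_, ?_, htail⟩, (add_sub_cancel _ _).symm⟩
      rw [SetLike.mem_coe, Submodule.mem_comap, htail]
      exact N.sub_mem hy (N.smul_mem a hxN)

lemma exists_isSMulRegular_of_maximalIdeal_notMem_associatedPrimes {A M : Type*} [CommRing A]
    [IsLocalRing A] [IsNoetherianRing A] [AddCommGroup M] [Module A M] [Module.Finite A M]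
    (hM : maximalIdeal A ∉ associatedPrimes A M) {J : Ideal A} (hJ : ¬ maximalIdeal A ≤ J) :
    ∃ z ∈ maximalIdeal A, z ∉ J ∧ IsSMulRegular M z := by
  by_contra! hz
  have hcover : (maximalIdeal A : Set A) ⊆ ⋃ p ∈ insert J (associatedPrimes A M), p := by
    intro z hzm
    by_cases hzJ : z ∈ J
    · exact Set.mem_biUnion (Set.mem_insert _ _) hzJ
    · have := (biUnion_associatedPrimes_eq_compl_regular A M).ge (hz z hzm hzJ)
      exact Set.biUnion_subset_biUnion_left (Set.subset_insert _ _) this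
  obtain ⟨p, hp, hle⟩ := (Ideal.subset_union_prime_finite ((associatedPrimes.finite A M).insert J)
    J J fun p hp hpJ _ ↦ (hp.resolve_left hpJ).isPrime).1 hcover
  obtain rfl | hp := hp
  · exact hJ hle
  · exact hM (hle.antisymm (le_maximalIdeal hp.isPrime.ne_top) ▸ hp)

lemma spanFinrank_maximalIdeal_quotient_span_singleton_le {A : Type*} [CommRing A] [IsLocalRing A]
    [IsNoetherianRing A] {n : ℕ} (hA : (maximalIdeal A).spanFinrank ≤ n + 1) {z : A}
    (hz : z ∈ maximalIdeal A) (hz2 : z ∉ maximalIdeal A ^ 2) [IsLocalRing (A ⧸ Ideal.span {z})] :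
    (maximalIdeal (A ⧸ Ideal.span {z})).spanFinrank ≤ n := by
  obtain ⟨x, hx⟩ := exists_span_range_eq_of_spanFinrank_le (IsNoetherian.noetherian _) hA
  obtain ⟨a, ha⟩ : ∃ a : Fin (n + 1) → A, ∑ k, a k • x k = z :=
    (Submodule.mem_span_range_iff_exists_fun A).1 (hx.ge hz)
  obtain ⟨k, hk⟩ : ∃ k, IsUnit (a k) := by
    by_contra! hk
    refine hz2 (ha ▸ sum_mem fun k _ ↦ sq (maximalIdeal A) ▸ Ideal.mul_mem_mul (hk k) ?_)
    exact hx.le (Submodule.subset_span ⟨k, rfl⟩)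
  let y (l : Fin (n + 1)) : A ⧸ Ideal.span {z} := Ideal.Quotient.mk _ (x l)
  let I : Ideal (A ⧸ Ideal.span {z}) := Ideal.span (Set.range (y ∘ k.succAbove))
  have hyI (l : Fin n) : y (k.succAbove l) ∈ I := Ideal.subset_span ⟨l, rfl⟩
  have hyk : y k ∈ I := by
    have hsum : Ideal.Quotient.mk _ (a k) * y k +
        ∑ l, Ideal.Quotient.mk _ (a (k.succAbove l)) * y (k.succAbove l) = 0 := by
      rw [← Fin.sum_univ_succAbove (fun l ↦ Ideal.Quotient.mk _ (a l) * y l) k]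
      simpa [y] using congr_arg (Ideal.Quotient.mk (Ideal.span {z})) ha
    rw [← Ideal.unit_mul_mem_iff_mem I (hk.map (Ideal.Quotient.mk (Ideal.span {z}))),
      eq_neg_of_add_eq_zero_left hsum]
    exact neg_mem (sum_mem fun l _ ↦ I.mul_mem_left _ (hyI l))
  have hI : maximalIdeal (A ⧸ Ideal.span {z}) = I := by
    rw [← map_maximalIdeal_of_surjective _ Ideal.Quotient.mk_surjective, ← hx]
    change (Ideal.span (Set.range x)).map _ = I
    rw [Ideal.map_span, ← Set.range_comp]
    refine le_antisymm (Ideal.span_le.2 (Set.range_subset_iff.2 fun l ↦ ?_))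
      (Ideal.span_mono (Set.range_comp_subset_range _ _))
    exact Fin.succAboveCases k hyk hyI l
  exact hI ▸ spanFinrank_span_range_le _

lemma inf_ker_mapCoordinates_le_smul {A M : Type*} [CommRing A] [AddCommGroup M] [Module A M]
    {ι : Type*} [Finite ι] (π : (ι → A) →ₗ[A] M) {z : A} (hz : IsSMulRegular M z) :
    LinearMap.ker π ⊓ LinearMap.ker (mapCoordinates (Ideal.Quotient.mk (Ideal.span {z})) ι) ≤
      Ideal.span {z} • LinearMap.ker π := by
  rintro x ⟨hx, hxz⟩
  rw [SetLike.mem_coe, ker_mapCoordinates, Ideal.mk_ker, Submodule.ideal_span_singleton_smul] at hxz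
  obtain ⟨y, -, rfl⟩ := (Submodule.mem_smul_pointwise_iff_exists ..).1 hxz
  refine Submodule.smul_mem_smul (Ideal.mem_span_singleton_self z) (hz ?_)
  simpa using hx

lemma exists_span_range_eq_ker {A M : Type*} [CommRing A] [IsLocalRing A] [IsNoetherianRing A]
    [AddCommGroup M] [Module A M] [Module.Finite A M] (hA : (maximalIdeal A).spanFinrank ≤ 2)
    (hM : maximalIdeal A ∉ associatedPrimes A M) {n : ℕ} (π : (Fin n → A) →ₗ[A] M) :
    ∃ v : Fin n → Fin n → A, Submodule.span A (Set.range v) = LinearMap.ker π := by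
  by_cases hsq : maximalIdeal A ≤ maximalIdeal A ^ 2
  · have hbot : maximalIdeal A = ⊥ := Submodule.eq_bot_of_le_smul_of_le_jacobson_bot
      (maximalIdeal A) _ (IsNoetherian.noetherian _) (hsq.trans_eq (sq _))
      (maximalIdeal_le_jacobson _)
    have := isPrincipalIdealRing_of_spanFinrank_maximalIdeal_le_one
      (by simp [hbot] : (maximalIdeal A).spanFinrank ≤ 1)
    exact exists_span_range_eq_of_isPrincipalIdealRing _
  obtain ⟨z, hz, hz2, hreg⟩ := exists_isSMulRegular_of_maximalIdeal_notMem_associatedPrimes hM hsq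
  have hne : Ideal.span {z} ≠ ⊤ := ((Ideal.span_singleton_le_iff_mem _).2 hz).trans_lt
    (maximalIdeal.isMaximal A).ne_top.lt_top |>.ne
  have := Ideal.Quotient.nontrivial_iff.2 hne
  have := IsLocalRing.of_surjective' (Ideal.Quotient.mk (Ideal.span {z}))
    Ideal.Quotient.mk_surjective
  have := isPrincipalIdealRing_of_spanFinrank_maximalIdeal_le_one
    (spanFinrank_maximalIdeal_quotient_span_singleton_le hA hz hz2)
  obtain ⟨v', hv'⟩ := exists_span_range_eq_of_isPrincipalIdealRing
    ((LinearMap.ker π).map (mapCoordinates (Ideal.Quotient.mk (Ideal.span {z})) (Fin n)))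
  exact exists_span_range_eq_of_span_range_eq_map _
    (((Ideal.span_singleton_le_iff_mem _).2 hz).trans (maximalIdeal_le_jacobson _))
    (IsNoetherian.noetherian _) (inf_ker_mapCoordinates_le_smul π hreg) hv'

end Generators

section Lifting

open scoped TensorProduct

lemma inf_smul_top_le_smul_ker_of_flat {R M Q : Type*} [CommRing R] [AddCommGroup M] [Module R M]
    [AddCommGroup Q] [Module R Q] [Module.Flat R Q] {f : M →ₗ[R] Q}
    (hf : Function.Surjective f) (I : Ideal R) :
    LinearMap.ker f ⊓ I • ⊤ ≤ I • LinearMap.ker f := by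
  rintro x ⟨hx, hxI⟩
  have hinj := LinearMap.lTensor_injective_of_exact_of_flat f hf (LinearMap.ker f).subtype
    (LinearMap.ker f).subtype_injective (LinearMap.exact_subtype_ker_map f) (R ⧸ I)
  have htmul : (1 : R ⧸ I) ⊗ₜ[R] (⟨x, hx⟩ : LinearMap.ker f) = 0 := hinj <| by
    rw [map_zero, LinearMap.lTensor_tmul, Submodule.subtype_apply,
      ← TensorProduct.quotTensorEquivQuotSMul_symm_mk, (Submodule.Quotient.mk_eq_zero _).2 hxI,
      map_zero]
  rw [← TensorProduct.quotTensorEquivQuotSMul_symm_mk, LinearEquiv.map_eq_zero_iff,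
    Submodule.Quotient.mk_eq_zero] at htmul
  have hmap := Submodule.mem_map_of_mem (f := (LinearMap.ker f).subtype) htmul
  rwa [Submodule.map_smul'', Submodule.map_top, Submodule.range_subtype] at hmap

lemma inf_ker_mapCoordinates_le_smul_of_flat {R A A' M ι : Type*} [CommRing R] [CommRing A]
    [CommRing A'] [Algebra R A] [AddCommGroup M] [Module R M] [Module A M] [IsScalarTower R A M]
    [Module.Flat R M] [Finite ι] {σ : A →+* A'} {I : Ideal R}
    (hσ : RingHom.ker σ = I.map (algebraMap R A)) {π : (ι → A) →ₗ[A] M}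
    (hπ : Function.Surjective π) :
    LinearMap.ker π ⊓ LinearMap.ker (mapCoordinates σ ι) ≤ RingHom.ker σ • LinearMap.ker π := by
  rw [ker_mapCoordinates, hσ]
  rintro x ⟨hx, hxI⟩
  rw [SetLike.mem_coe, ← Submodule.restrictScalars_mem R, Ideal.smul_restrictScalars,
    Submodule.restrictScalars_top] at hxI
  rw [← Submodule.restrictScalars_mem R, Ideal.smul_restrictScalars]
  exact inf_smul_top_le_smul_ker_of_flat (f := π.restrictScalars R) hπ I ⟨hx, hxI⟩

section

variable {A A' M M' ι : Type*} [CommRing A] [CommRing A'] [AddCommGroup M] [AddCommGroup M']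
  [Module A M] [Module A' M'] {σ : A →+* A'} [RingHomSurjective σ] {f : M →ₛₗ[σ] M'}
  {π : (ι → A) →ₗ[A] M} {π' : (ι → A') →ₗ[A'] M'}

lemma surjective_of_comp_eq_comp_mapCoordinates [Module.Finite A M]
    (hσ : RingHom.ker σ ≤ Ideal.jacobson ⊥) (hf : LinearMap.ker f = RingHom.ker σ • ⊤)
    (hcomp : ∀ x, f (π x) = π' (mapCoordinates σ ι x)) (hπ' : Function.Surjective π') :
    Function.Surjective π := by
  rw [← LinearMap.range_eq_top, ← top_le_iff]
  refine le_of_map_le_map_of_inf_ker_le_smul f hσ Module.Finite.fg_top le_top (by simp [hf]) ?_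
  rintro _ ⟨m, -, rfl⟩
  obtain ⟨x, hx⟩ := (hπ'.comp (mapCoordinates_surjective σ ι)) (f m)
  exact ⟨π x, ⟨x, rfl⟩, (hcomp x).trans hx⟩

lemma map_mapCoordinates_ker [Finite ι] (hπ : Function.Surjective π)
    (hf : LinearMap.ker f = RingHom.ker σ • ⊤)
    (hcomp : ∀ x, f (π x) = π' (mapCoordinates σ ι x)) :
    (LinearMap.ker π).map (mapCoordinates σ ι) = LinearMap.ker π' := by
  refine le_antisymm (Submodule.map_le_iff_le_comap.2 fun x hx ↦ ?_) fun x' hx' ↦ ?_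
  · rw [Submodule.mem_comap, LinearMap.mem_ker, ← hcomp, LinearMap.mem_ker.1 hx, map_zero]
  obtain ⟨x, rfl⟩ := mapCoordinates_surjective σ ι x'
  obtain ⟨y, hy, hyx⟩ : π x ∈ (LinearMap.ker (mapCoordinates σ ι)).map π := by
    rw [ker_mapCoordinates, Submodule.map_smul'', Submodule.map_top, LinearMap.range_eq_top.2 hπ,
      ← hf, LinearMap.mem_ker, hcomp]
    exact hx'
  exact ⟨x - y, by simp [hyx], by rw [map_sub, LinearMap.mem_ker.1 hy, sub_zero]⟩

end

end Lifting

section Conductor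

variable {A B : Type*} [CommRing A] [CommRing B] [Algebra A B]

variable (A B) in
/-- The conductor of an `A`-algebra `B`: the annihilator of the `A`-module `B / A`. -/
def conductor : Ideal A :=
  Module.annihilator A (B ⧸ LinearMap.range (Algebra.linearMap A B))

lemma mem_conductor {a : A} :
    a ∈ conductor A B ↔ ∀ b : B, ∃ c, algebraMap A B c = algebraMap A B a * b := by
  simp only [conductor, Module.mem_annihilator, Submodule.Quotient.forall,
    ← Submodule.Quotient.mk_smul, Submodule.Quotient.mk_eq_zero, LinearMap.mem_range,
    Algebra.linearMap_apply, Algebra.smul_def]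

lemma conductor_eq_top_iff : conductor A B = ⊤ ↔ Function.Surjective (algebraMap A B) := by
  simp [Ideal.eq_top_iff_one, mem_conductor, Function.Surjective]

lemma ker_algebraMap_le_conductor : RingHom.ker (algebraMap A B) ≤ conductor A B :=
  fun a ha ↦ mem_conductor.2 fun b ↦ ⟨0, by rw [RingHom.mem_ker.1 ha, map_zero, zero_mul]⟩

lemma map_conductor {A' B' : Type*} [CommRing A'] [CommRing B'] [Algebra A' B'] {σ : A →+* A'}
    (hσ : Function.Surjective σ) (e : B ≃+* B')
    (he : ∀ a, e (algebraMap A B a) = algebraMap A' B' (σ a)) :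
    (conductor A B).map σ = conductor A' B' := by
  have hmem (a : A) : σ a ∈ conductor A' B' ↔ a ∈ conductor A B := by
    simp only [mem_conductor, e.surjective.forall, hσ.exists, ← he, ← map_mul, e.injective.eq_iff]
  have hcomap : conductor A B = (conductor A' B').comap σ := Ideal.ext fun a ↦ (hmem a).symm
  rw [hcomap, Ideal.map_comap_of_surjective σ hσ]

variable (A) in
/-- The linear map `A² → B`, `(a, b) ↦ a + b v`. -/
def pairMap (v : B) : (Fin 2 → A) →ₗ[A] B :=
  (LinearMap.proj 0).smulRight 1 + (LinearMap.proj 1).smulRight v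

lemma pairMap_apply (v : B) (x : Fin 2 → A) :
    pairMap A v x = algebraMap A B (x 0) + algebraMap A B (x 1) * v := by
  simp [pairMap, Algebra.smul_def]

variable {v : B}

lemma map_proj_one_ker_pairMap (hv : Function.Surjective (pairMap A v)) :
    (LinearMap.ker (pairMap A v)).map (LinearMap.proj 1) = conductor A B := by
  ext a
  rw [Submodule.mem_map, mem_conductor]
  refine ⟨?_, fun ha ↦ ?_⟩
  · rintro ⟨x, hx, rfl⟩ b
    obtain ⟨y, rfl⟩ := hv b
    rw [LinearMap.mem_ker, pairMap_apply] at hx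
    refine ⟨x 1 * y 0 - x 0 * y 1, ?_⟩
    simp only [pairMap_apply, map_sub, map_mul, LinearMap.proj_apply]
    linear_combination -(algebraMap A B (y 1)) * hx
  · obtain ⟨c, hc⟩ := ha v
    exact ⟨![-c, a], by simp [pairMap_apply, hc], rfl⟩

lemma map_proj_zero_ker_pairMap_le (hv : Function.Surjective (pairMap A v)) :
    (LinearMap.ker (pairMap A v)).map (LinearMap.proj 0) ≤ conductor A B := by
  rintro _ ⟨x, hx, rfl⟩
  have hx1 : x 1 ∈ conductor A B := (map_proj_one_ker_pairMap hv).le ⟨x, hx, rfl⟩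
  rw [SetLike.mem_coe, LinearMap.mem_ker, pairMap_apply] at hx
  rw [LinearMap.proj_apply, mem_conductor]
  intro b
  obtain ⟨c, hc⟩ := mem_conductor.1 hx1 (v * b)
  refine ⟨-c, ?_⟩
  rw [map_neg, hc]
  linear_combination -b * hx

lemma exists_pairMap_surjective_of_isSimpleModule
    [IsSimpleModule A (B ⧸ LinearMap.range (Algebra.linearMap A B))] :
    ∃ v : B, Function.Surjective (pairMap A v) := by
  have := IsSimpleModule.nontrivial A (B ⧸ LinearMap.range (Algebra.linearMap A B))
  obtain ⟨w, hw⟩ := exists_ne (0 : B ⧸ LinearMap.range (Algebra.linearMap A B))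
  obtain ⟨v, rfl⟩ := Submodule.Quotient.mk_surjective _ w
  refine ⟨v, fun b ↦ ?_⟩
  obtain ⟨d, hd⟩ := IsSimpleModule.toSpanSingleton_surjective A hw (Submodule.Quotient.mk b)
  rw [LinearMap.toSpanSingleton_apply, ← Submodule.Quotient.mk_smul, eq_comm,
    Submodule.Quotient.eq] at hd
  obtain ⟨c, hc⟩ := hd
  refine ⟨![c, d], ?_⟩
  rw [Algebra.linearMap_apply, Algebra.smul_def] at hc
  simp only [pairMap_apply, Matrix.cons_val_zero, Matrix.cons_val_one]
  rw [hc, sub_add_cancel]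

lemma pairMap_symm_surjective {A' B' : Type*} [CommRing A'] [CommRing B'] [Algebra A' B']
    {σ : A →+* A'} (hσ : Function.Surjective σ) (e : B ≃+* B')
    (he : ∀ a, e (algebraMap A B a) = algebraMap A' B' (σ a)) {v' : B'}
    (hv' : Function.Surjective (pairMap A' v')) :
    Function.Surjective (pairMap A (e.symm v')) := by
  intro b
  obtain ⟨x', hx'⟩ := hv' (e b)
  obtain ⟨x, rfl⟩ := hσ.comp_left x'
  refine ⟨x, e.injective ?_⟩
  rw [← hx', pairMap_apply, pairMap_apply, map_add, map_mul, he, he, e.apply_symm_apply]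
  rfl

lemma exists_matrix_presentation (hv : Function.Surjective (pairMap A v)) {r : Fin 2 → Fin 2 → A}
    (hr : Submodule.span A (Set.range r) = LinearMap.ker (pairMap A v)) :
    ∃ g f s t : A,
      LinearMap.ker (pairMap A v) = LinearMap.range (!![g, f; s, t]).mulVecLin ∧
        g ∈ conductor A B ∧ f ∈ conductor A B ∧ Ideal.span {s, t} = conductor A B := by
  have hmem (k : Fin 2) : r k ∈ LinearMap.ker (pairMap A v) :=
    hr.le (Submodule.subset_span ⟨k, rfl⟩)
  refine ⟨r 0 0, r 1 0, r 0 1, r 1 1, ?_,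
    map_proj_zero_ker_pairMap_le hv ⟨r 0, hmem 0, rfl⟩,
    map_proj_zero_ker_pairMap_le hv ⟨r 1, hmem 1, rfl⟩, ?_⟩
  · have hcol : !![r 0 0, r 1 0; r 0 1, r 1 1].col = r := by
      ext j k; fin_cases j <;> fin_cases k <;> rfl
    rw [Matrix.range_mulVecLin, hcol, hr]
  · have hrow : {r 0 1, r 1 1} = Set.range (LinearMap.proj (R := A) 1 ∘ r) := by
      ext x; simp [Fin.exists_fin_two, eq_comm]
    rw [← map_proj_one_ker_pairMap hv, ← hr, Submodule.map_span, ← Set.range_comp, hrow]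

theorem exists_presentation_of_reduction {R A B A' B' : Type*} [CommRing R] [CommRing A]
    [CommRing B] [CommRing A'] [CommRing B'] [Algebra R A] [Algebra A B] [Algebra R B]
    [IsScalarTower R A B] [Algebra A' B'] [IsNoetherianRing A] [Module.Finite A B]
    [Module.Flat R B] {I : Ideal R} {σ : A →+* A'} (hσ : Function.Surjective σ)
    (hσI : RingHom.ker σ = I.map (algebraMap R A)) (hjac : RingHom.ker σ ≤ Ideal.jacobson ⊥)
    {ψ : B →+* B'} (hψ : Function.Surjective ψ)
    (hψσ : RingHom.ker ψ = (RingHom.ker σ).map (algebraMap A B))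
    (hcomp : ∀ a, ψ (algebraMap A B a) = algebraMap A' B' (σ a))
    {v' : B'} (hv' : Function.Surjective (pairMap A' v')) {ι : Type*} {r' : ι → Fin 2 → A'}
    (hr' : Submodule.span A' (Set.range r') = LinearMap.ker (pairMap A' v')) :
    ∃ v : B, Function.Surjective (pairMap A v) ∧ ∃ r : ι → Fin 2 → A,
      Submodule.span A (Set.range r) = LinearMap.ker (pairMap A v) := by
  have : RingHomSurjective σ := ⟨hσ⟩
  obtain ⟨v, rfl⟩ := hψ v'
  let f : B →ₛₗ[σ] B' :=
    { ψ with map_smul' := fun a b ↦ by simp [Algebra.smul_def, hcomp] }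
  have hf : LinearMap.ker f = RingHom.ker σ • ⊤ := by
    rw [Ideal.smul_top_eq_map, ← hψσ]
    rfl
  have hfπ (x : Fin 2 → A) : f (pairMap A v x) = pairMap A' (ψ v) (mapCoordinates σ _ x) := by
    simp [f, pairMap_apply, hcomp]
  have hv := surjective_of_comp_eq_comp_mapCoordinates hjac hf hfπ hv'
  refine ⟨v, hv, exists_span_range_eq_of_span_range_eq_map (v' := r') (mapCoordinates σ _) hjac
    (IsNoetherian.noetherian _) (inf_ker_mapCoordinates_le_smul_of_flat hσI hv) ?_⟩
  rw [hr', map_mapCoordinates_ker hv hf hfπ]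

end Conductor

section PushforwardStalk

open TopologicalSpace

variable {X Y : Scheme.{u}} (i : X ⟶ Y)

/-- The germ at `y` of a section of `i_* 𝒪_X` over `U`. -/
def pushforwardGerm (U : Y.Opens) (y : Y) (hy : y ∈ U) : Γ(X, i ⁻¹ᵁ U) →+* PushforwardStalk i y :=
  ((i.base _* X.presheaf).germ U y hy).hom

lemma algebraMap_germ (U : Y.Opens) (y : Y) (hy : y ∈ U) (c : Γ(Y, U)) :
    algebraMap (Y.presheaf.stalk y) (PushforwardStalk i y) (Y.presheaf.germ U y hy c) =
      pushforwardGerm i U y hy (i.app U c) :=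
  TopCat.Presheaf.stalkFunctor_map_germ_apply (C := CommRingCat.{u}) U y hy i.c c

lemma pushforwardGerm_res {U V : Y.Opens} (h : V ≤ U) (y : Y) (hy : y ∈ V) (e : Γ(X, i ⁻¹ᵁ U)) :
    pushforwardGerm i V y hy (X.presheaf.map (homOfLE (i.preimage_mono h)).op e) =
      pushforwardGerm i U y (h hy) e :=
  TopCat.Presheaf.germ_res_apply (C := CommRingCat.{u}) (i.base _* X.presheaf) (homOfLE h) y hy e

lemma exists_pushforwardGerm_mul_eq [IsAffineHom i] {U : Y.Opens} (hU : IsAffineOpen U) (y : Y)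
    (hy : y ∈ U) (b : PushforwardStalk i y) :
    ∃ (e : Γ(X, i ⁻¹ᵁ U)) (c : Γ(Y, U)), y ∈ Y.basicOpen c ∧
      b * pushforwardGerm i U y hy (i.app U c) = pushforwardGerm i U y hy e := by
  obtain ⟨V, hyV, σ, rfl⟩ :=
    TopCat.Presheaf.exists_germ_eq (C := CommRingCat.{u}) (i.base _* X.presheaf) b
  obtain ⟨c, hcV, hyc⟩ := hU.exists_basicOpen_le ⟨y, hyV⟩ hy
  have hle := i.preimage_mono (Y.basicOpen_le c)
  let := (X.presheaf.map (homOfLE hle).op).hom.toAlgebra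
  have := (hU.preimage i).isLocalization_of_eq_basicOpen (i.app U c) (homOfLE hle)
    (Scheme.preimage_basicOpen i c)
  obtain ⟨⟨e, ⟨_, n, rfl⟩⟩, he⟩ := IsLocalization.surj (Submonoid.powers (i.app U c))
    (X.presheaf.map (homOfLE (i.preimage_mono hcV)).op σ)
  refine ⟨e, c ^ n, ?_, ?_⟩
  · rw [Y.mem_basicOpen _ y hy, map_pow]
    exact ((Y.mem_basicOpen _ y hy).1 hyc).pow n
  · change pushforwardGerm i V y hyV σ * _ = _
    rw [map_pow, ← pushforwardGerm_res i hcV y hyc,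
      ← pushforwardGerm_res i (Y.basicOpen_le c) y hyc,
      ← pushforwardGerm_res i (Y.basicOpen_le c) y hyc e, ← map_mul]
    exact congr_arg _ he

lemma exists_mul_eq_mul_of_pushforwardGerm_eq [IsAffineHom i] {U : Y.Opens} (hU : IsAffineOpen U)
    (y : Y) (hy : y ∈ U) {e e' : Γ(X, i ⁻¹ᵁ U)}
    (h : pushforwardGerm i U y hy e = pushforwardGerm i U y hy e') :
    ∃ c : Γ(Y, U), y ∈ Y.basicOpen c ∧ i.app U c * e = i.app U c * e' := by
  obtain ⟨V, hyV, hVU, _, hV⟩ :=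
    TopCat.Presheaf.germ_eq (C := CommRingCat.{u}) (i.base _* X.presheaf) y hy hy e e' h
  obtain ⟨c, hcV, hyc⟩ := hU.exists_basicOpen_le ⟨y, hyV⟩ hy
  have hle := i.preimage_mono (Y.basicOpen_le c)
  let := (X.presheaf.map (homOfLE hle).op).hom.toAlgebra
  have := (hU.preimage i).isLocalization_of_eq_basicOpen (i.app U c) (homOfLE hle)
    (Scheme.preimage_basicOpen i c)
  have hres : algebraMap Γ(X, i ⁻¹ᵁ U) Γ(X, i ⁻¹ᵁ (Y.basicOpen c)) e =
      algebraMap Γ(X, i ⁻¹ᵁ U) Γ(X, i ⁻¹ᵁ (Y.basicOpen c)) e' := by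
    have := congr_arg (X.presheaf.map (homOfLE (i.preimage_mono hcV)).op) hV
    simp only [TopCat.Presheaf.pushforward_obj_map, ← CommRingCat.comp_apply,
      ← Functor.map_comp] at this
    exact this
  obtain ⟨⟨_, n, rfl⟩, hn⟩ := IsLocalization.exists_of_eq (M := Submonoid.powers (i.app U c)) hres
  refine ⟨c ^ n, ?_, by rwa [map_pow]⟩
  rw [Y.mem_basicOpen _ y hy, map_pow]
  exact ((Y.mem_basicOpen _ y hy).1 hyc).pow n

lemma mem_primeCompl_primeIdealOf {U : Y.Opens} (hU : IsAffineOpen U) (y : Y) (hy : y ∈ U)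
    (c : Γ(Y, U)) : c ∈ (hU.primeIdealOf ⟨y, hy⟩).asIdeal.primeCompl ↔ y ∈ Y.basicOpen c := by
  let := Y.presheaf.algebra_section_stalk ⟨y, hy⟩
  have := hU.isLocalization_stalk ⟨y, hy⟩
  rw [Y.mem_basicOpen c y hy]
  exact (IsLocalization.AtPrime.isUnit_to_map_iff (Y.presheaf.stalk y)
    (hU.primeIdealOf ⟨y, hy⟩).asIdeal c).symm

theorem isLocalization_pushforwardGerm [IsAffineHom i] {U : Y.Opens} (hU : IsAffineOpen U) (y : Y)
    (hy : y ∈ U) :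
    letI := (pushforwardGerm i U y hy).toAlgebra
    IsLocalization ((hU.primeIdealOf ⟨y, hy⟩).asIdeal.primeCompl.map (i.app U).hom)
      (PushforwardStalk i y) := by
  let := (pushforwardGerm i U y hy).toAlgebra
  refine (isLocalization_iff _ _).2 ⟨?_, fun b ↦ ?_, fun {_ _} h ↦ ?_⟩
  · rintro ⟨_, c, hc, rfl⟩
    have hunit := (Y.mem_basicOpen c y hy).1 ((mem_primeCompl_primeIdealOf hU y hy c).1 hc)
    have := hunit.map (algebraMap (Y.presheaf.stalk y) (PushforwardStalk i y))
    rwa [algebraMap_germ] at this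
  · obtain ⟨e, c, hc, he⟩ := exists_pushforwardGerm_mul_eq i hU y hy b
    exact ⟨⟨e, _, c, (mem_primeCompl_primeIdealOf hU y hy c).2 hc, rfl⟩, he⟩
  · obtain ⟨c, hc, he⟩ := exists_mul_eq_mul_of_pushforwardGerm_eq i hU y hy h
    exact ⟨⟨_, c, (mem_primeCompl_primeIdealOf hU y hy c).2 hc, rfl⟩, he⟩

theorem exists_pushforwardStalk_ringEquiv {Z : Scheme.{u}} (f : X ⟶ Z) (ι : Z ⟶ Y)
    [IsClosedImmersion ι] (η : Z) :
    ∃ e : PushforwardStalk (f ≫ ι) (ι η) ≃+* PushforwardStalk f η,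
      ∀ a, e (algebraMap _ _ a) = algebraMap _ _ (ι.stalkMap η a) := by
  have : IsIso ((f.base _* X.presheaf).stalkPushforward CommRingCat.{u} ι.base η) :=
    TopCat.Presheaf.stalkPushforward.stalkPushforward_iso_of_isInducing CommRingCat.{u}
      ι.isClosedEmbedding.isInducing _ η
  let e : PushforwardStalk (f ≫ ι) (ι η) ≃+* PushforwardStalk f η :=
    (asIso ((f.base _* X.presheaf).stalkPushforward
      CommRingCat.{u} ι.base η)).commRingCatIsoToRingEquiv
  refine ⟨e, fun a ↦ ?_⟩
  obtain ⟨U, hU, c, rfl⟩ := TopCat.Presheaf.exists_germ_eq Y.presheaf a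
  calc e (algebraMap _ _ (Y.presheaf.germ U (ι η) hU c))
      = e (pushforwardGerm (f ≫ ι) U (ι η) hU ((f ≫ ι).app U c)) :=
        congr_arg e (algebraMap_germ (f ≫ ι) U (ι η) hU c)
    _ = pushforwardGerm f (ι ⁻¹ᵁ U) η hU ((f ≫ ι).app U c) :=
        congr($(TopCat.Presheaf.stalkPushforward_germ CommRingCat.{u} ι.base
          (f.base _* X.presheaf) U η hU) ((f ≫ ι).app U c))
    _ = pushforwardGerm f (ι ⁻¹ᵁ U) η hU (f.app (ι ⁻¹ᵁ U) (ι.app U c)) := by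
        rw [Scheme.Hom.comp_app]; rfl
    _ = algebraMap _ _ (Z.presheaf.germ (ι ⁻¹ᵁ U) η hU (ι.app U c)) :=
        (algebraMap_germ f (ι ⁻¹ᵁ U) η hU (ι.app U c)).symm
    _ = algebraMap _ _ (ι.stalkMap η (Y.presheaf.germ U (ι η) hU c)) :=
        congr_arg _ (Scheme.Hom.germ_stalkMap_apply ..).symm

end PushforwardStalk

section Fibre

open scoped TensorProduct in
lemma surjective_and_ker_eq_of_isPushout {S T C P : CommRingCat.{u}} {f : S ⟶ C} {g : S ⟶ T}
    {inl : C ⟶ P} {inr : T ⟶ P} (h : IsPushout f g inl inr) (hg : Function.Surjective g.hom) :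
    Function.Surjective inl.hom ∧ RingHom.ker inl.hom = (RingHom.ker g.hom).map f.hom := by
  algebraize [f.hom, g.hom, inl.hom, inr.hom, inl.hom.comp f.hom]
  have : IsScalarTower S T P := .of_algebraMap_eq' congr($(h.w).hom)
  have : Algebra.IsPushout S C T P := CommRingCat.isPushout_iff_isPushout.1 h
  let e : C ⊗[S] T ≃ₐ[C] P := Algebra.IsPushout.equiv S C T P
  let r : C ⊗[S] S ≃ₐ[C] C := Algebra.TensorProduct.rid S C C
  let γ : C ⊗[S] S →ₐ[C] C ⊗[S] T := Algebra.TensorProduct.map (.id C C) (Algebra.ofId S T)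
  have hr : (Algebra.ofId C P).comp r.toAlgHom = e.toAlgHom.comp γ :=
    Algebra.TensorProduct.ext (by ext) (by ext)
  have hker : (RingHom.ker inl.hom).comap r = RingHom.ker γ :=
    Ideal.ext fun x ↦ (congr($hr x) ▸ e.map_eq_zero_iff : inl.hom (r x) = 0 ↔ γ x = 0)
  refine ⟨fun p ↦ ?_, ?_⟩
  · obtain ⟨c, hc⟩ := Algebra.TensorProduct.includeLeft_surjective C C hg (e.symm p)
    exact ⟨c, (e.commutes c).symm.trans (by rw [← e.apply_symm_apply p, ← hc]; rfl)⟩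
  have hγ : RingHom.ker γ = (RingHom.ker (Algebra.ofId S T)).map
      (Algebra.TensorProduct.includeRight : S →ₐ[S] C ⊗[S] S) :=
    Algebra.TensorProduct.lTensor_ker (A := C) (Algebra.ofId S T) hg
  have hrf : (r.toAlgHom.restrictScalars S).comp Algebra.TensorProduct.includeRight =
      Algebra.ofId S C := Subsingleton.elim _ _
  rw [← Ideal.map_comap_of_surjective r r.surjective (RingHom.ker inl.hom), hker, hγ]
  exact (Ideal.map_map _ _).trans
    (congr_arg (Ideal.map · (RingHom.ker g.hom)) (congr_arg AlgHom.toRingHom hrf))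

lemma preimage_preimage_eq_of_isPullback {P X T S : Scheme.{u}} {k : P ⟶ X} {l : P ⟶ T} {f : X ⟶ S}
    {g : T ⟶ S} (H : IsPullback k l f g) (U : S.Opens) :
    l ⁻¹ᵁ g ⁻¹ᵁ U = k ⁻¹ᵁ f ⁻¹ᵁ U := by
  rw [← Scheme.Hom.comp_preimage, ← H.w, Scheme.Hom.comp_preimage]

lemma app_comp_appLE_of_isPullback {P X T S : Scheme.{u}} {k : P ⟶ X} {l : P ⟶ T} {f : X ⟶ S}
    {g : T ⟶ S} (H : IsPullback k l f g) (U : S.Opens) :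
    f.app U ≫ k.appLE (f ⁻¹ᵁ U) (l ⁻¹ᵁ g ⁻¹ᵁ U) (preimage_preimage_eq_of_isPullback H U).le =
      g.app U ≫ l.app (g ⁻¹ᵁ U) := by
  simp only [Scheme.Hom.app_eq_appLE, Scheme.Hom.appLE_comp_appLE, H.w]

lemma appLE_surjective_and_ker_eq {P X T S : Scheme.{u}} {k : P ⟶ X} {l : P ⟶ T} {f : X ⟶ S}
    {g : T ⟶ S} (H : IsPullback k l f g) [IsAffineHom g] {US : S.Opens} (hUS : IsAffineOpen US)
    (hg : Function.Surjective (g.app US)) {UX : X.Opens} (hUX : IsAffineOpen UX)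
    (hXS : UX ≤ f ⁻¹ᵁ US) {UP : P.Opens} (hUP : UP = k ⁻¹ᵁ UX) :
    Function.Surjective (k.appLE UX UP hUP.le) ∧
      RingHom.ker (k.appLE UX UP hUP.le).hom =
        (RingHom.ker (g.app US).hom).map (f.appLE US UX hXS).hom := by
  subst hUP
  have hPT : k ⁻¹ᵁ UX ≤ l ⁻¹ᵁ g ⁻¹ᵁ US :=
    (k.preimage_mono hXS).trans (preimage_preimage_eq_of_isPullback H US).ge
  have hpush := (isIso_pushoutSection_iff H le_rfl hXS (inf_eq_left.2 hPT).symm).1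
    (isIso_pushoutSection_of_isAffineOpen H _ _ _ hUS (hUS.preimage g) hUX)
  rw [← Scheme.Hom.app_eq_appLE] at hpush
  exact surjective_and_ker_eq_of_isPushout hpush hg

lemma Spec_map_app_top_surjective_and_ker_eq {R K : CommRingCat.{u}} (θ : R ⟶ K)
    (hθ : Function.Surjective θ) :
    Function.Surjective ((Spec.map θ).app ⊤) ∧
      RingHom.ker ((Spec.map θ).app ⊤).hom =
        (RingHom.ker θ.hom).map (Scheme.ΓSpecIso R).inv.hom := by
  change Function.Surjective (Spec.map θ).appTop ∧ RingHom.ker (Spec.map θ).appTop.hom = _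
  have hR := ConcreteCategory.bijective_of_isIso (Scheme.ΓSpecIso R).inv
  have hK := ConcreteCategory.bijective_of_isIso (Scheme.ΓSpecIso K).inv
  have hcomp : (Spec.map θ).appTop.hom.comp (Scheme.ΓSpecIso R).inv.hom =
      (Scheme.ΓSpecIso K).inv.hom.comp θ.hom :=
    congr($(Scheme.ΓSpecIso_inv_naturality θ).hom).symm
  refine ⟨.of_comp (g := (Scheme.ΓSpecIso R).inv) ?_, ?_⟩
  · have hsurj : Function.Surjective ((Scheme.ΓSpecIso K).inv.hom.comp θ.hom) :=
      hK.surjective.comp hθ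
    rwa [← hcomp] at hsurj
  · rw [← RingHom.ker_comp_of_injective θ.hom hK.injective, ← hcomp, ← RingHom.comap_ker,
      Ideal.map_comap_of_surjective _ hR.surjective]

lemma surjective_and_ker_eq_of_isLocalization {S S' L L' : Type*} [CommRing S] [CommRing S']
    [CommRing L] [CommRing L'] [Algebra S L] [Algebra S' L'] {φ : S →+* S'}
    (hφ : Function.Surjective φ) (M : Submonoid S) [IsLocalization M L]
    [IsLocalization (M.map φ) L'] {Φ : L →+* L'}
    (hΦ : Φ.comp (algebraMap S L) = (algebraMap S' L').comp φ) :
    Function.Surjective Φ ∧ RingHom.ker Φ = (RingHom.ker φ).map (algebraMap S L) := by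
  obtain rfl : Φ = IsLocalization.map L' φ M.le_comap_map :=
    IsLocalization.ringHom_ext M (hΦ.trans (IsLocalization.map_comp _).symm)
  exact ⟨IsLocalization.map_surjective_of_surjective M L L' hφ, IsLocalization.ker_map L' φ rfl⟩

lemma map_primeCompl_primeIdealOf {T S : Scheme.{u}} (g : T ⟶ S) [IsAffineHom g] {U : S.Opens}
    (hU : IsAffineOpen U) (hg : Function.Surjective (g.app U)) (P : T) (hP : g P ∈ U) :
    (hU.primeIdealOf ⟨g P, hP⟩).asIdeal.primeCompl.map (g.app U).hom =
      ((hU.preimage g).primeIdealOf ⟨P, hP⟩).asIdeal.primeCompl := by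
  have hmem (c : Γ(S, U)) : c ∈ (hU.primeIdealOf ⟨g P, hP⟩).asIdeal.primeCompl ↔
      g.app U c ∈ ((hU.preimage g).primeIdealOf ⟨P, hP⟩).asIdeal.primeCompl := by
    refine (mem_primeCompl_primeIdealOf hU (g P) hP c).trans
      (Iff.trans ?_ (mem_primeCompl_primeIdealOf (hU.preimage g) P hP (g.app U c)).symm)
    rw [← Scheme.preimage_basicOpen]
    rfl
  have hcomap : (hU.primeIdealOf ⟨g P, hP⟩).asIdeal.primeCompl =
      ((hU.preimage g).primeIdealOf ⟨P, hP⟩).asIdeal.primeCompl.comap (g.app U).hom :=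
    Submonoid.ext hmem
  rw [hcomap, Submonoid.map_comap_eq_of_surjective hg]

section

variable {T S : Scheme.{u}} (g : T ⟶ S) [IsClosedImmersion g] {U : S.Opens}

lemma ker_stalkMap_eq (hU : IsAffineOpen U) (P : T) (hP : g P ∈ U) :
    RingHom.ker (g.stalkMap P).hom =
      (RingHom.ker (g.app U).hom).map (S.presheaf.germ U (g P) hP).hom := by
  let := S.presheaf.algebra_section_stalk ⟨g P, hP⟩
  let : Algebra Γ(T, g ⁻¹ᵁ U) (T.presheaf.stalk P) := T.presheaf.algebra_section_stalk ⟨P, hP⟩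
  have := hU.isLocalization_stalk ⟨g P, hP⟩
  have hg := g.app_surjective U hU
  have : IsLocalization ((hU.primeIdealOf ⟨g P, hP⟩).asIdeal.primeCompl.map (g.app U).hom)
      (T.presheaf.stalk P) :=
    map_primeCompl_primeIdealOf g hU hg P hP ▸ (hU.preimage g).isLocalization_stalk ⟨P, hP⟩
  refine (surjective_and_ker_eq_of_isLocalization (φ := (g.app U).hom) hg
    (hU.primeIdealOf ⟨g P, hP⟩).asIdeal.primeCompl ?_).2
  exact congr($(Scheme.Hom.germ_stalkMap g U P hP).hom)

variable {P X : Scheme.{u}} {k : P ⟶ X} {l : P ⟶ T} {f : X ⟶ S}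

lemma exists_pushforwardGerm_comp_eq [IsAffineHom f] (H : IsPullback k l f g) (hU : IsAffineOpen U)
    (y : T) (hy : g y ∈ U) :
    let κ := (k.appLE _ _ (preimage_preimage_eq_of_isPullback H U).le).hom
    ∃ ψ : PushforwardStalk f (g y) →+* PushforwardStalk l y, Function.Surjective ψ ∧
      RingHom.ker ψ = (RingHom.ker κ).map (pushforwardGerm f U (g y) hy) ∧
      ψ.comp (pushforwardGerm f U (g y) hy) = (pushforwardGerm l (g ⁻¹ᵁ U) y hy).comp κ := by
  intro κ
  have : IsAffineHom l := MorphismProperty.of_isPullback H ‹_›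
  let N := (hU.primeIdealOf ⟨g y, hy⟩).asIdeal.primeCompl.map (f.app U).hom
  let := (pushforwardGerm f U (g y) hy).toAlgebra
  let := (pushforwardGerm l (g ⁻¹ᵁ U) y hy).toAlgebra
  have := isLocalization_pushforwardGerm f hU (g y) hy
  have hκapp : κ.comp (f.app U).hom = (l.app (g ⁻¹ᵁ U)).hom.comp (g.app U).hom :=
    congr($(app_comp_appLE_of_isPullback H U).hom)
  have hN : N.map κ =
      ((hU.preimage g).primeIdealOf ⟨y, hy⟩).asIdeal.primeCompl.map (l.app (g ⁻¹ᵁ U)).hom := by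
    rw [← map_primeCompl_primeIdealOf g hU (g.app_surjective U hU) y hy]
    exact (Submonoid.map_map _ κ.toMonoidHom (f.app U).hom.toMonoidHom).trans
      ((congr_arg (fun φ : _ →+* _ ↦ Submonoid.map φ.toMonoidHom _) hκapp).trans
        (Submonoid.map_map _ (l.app _).hom.toMonoidHom (g.app U).hom.toMonoidHom).symm)
  have : IsLocalization (N.map κ) (PushforwardStalk l y) :=
    hN ▸ isLocalization_pushforwardGerm l (hU.preimage g) y hy
  have hψ : (IsLocalization.map (PushforwardStalk l y) κ N.le_comap_map).comp
      (pushforwardGerm f U (g y) hy) = (pushforwardGerm l (g ⁻¹ᵁ U) y hy).comp κ :=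
    IsLocalization.map_comp _
  have hκ := (appLE_surjective_and_ker_eq H hU (g.app_surjective U hU) (hU.preimage f) le_rfl
    (preimage_preimage_eq_of_isPullback H U)).1
  obtain ⟨hψsurj, hψker⟩ := surjective_and_ker_eq_of_isLocalization hκ N hψ
  exact ⟨_, hψsurj, hψker, hψ⟩

theorem exists_pushforwardStalk_ringHom [IsAffineHom f] (H : IsPullback k l f g) (y : T) :
    ∃ ψ : PushforwardStalk f (g y) →+* PushforwardStalk l y, Function.Surjective ψ ∧
      RingHom.ker ψ = (RingHom.ker (g.stalkMap y).hom).map (algebraMap _ _) ∧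
      ψ.comp (algebraMap _ _) = (algebraMap _ _).comp (g.stalkMap y).hom := by
  obtain ⟨_, ⟨U, hU, rfl⟩, hyU, -⟩ :=
    S.isBasis_affineOpens.exists_subset_of_mem_open (Set.mem_univ (g y)) isOpen_univ
  have hκf := (appLE_surjective_and_ker_eq H hU (g.app_surjective U hU) (hU.preimage f) le_rfl
    (preimage_preimage_eq_of_isPullback H U)).2
  rw [← Scheme.Hom.app_eq_appLE] at hκf
  obtain ⟨ψ, hψsurj, hψker, hψ⟩ := exists_pushforwardGerm_comp_eq g H hU y hyU
  have hgerm : (algebraMap _ (PushforwardStalk f (g y))).comp (S.presheaf.germ U (g y) hyU).hom =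
      (pushforwardGerm f U (g y) hyU).comp (f.app U).hom :=
    RingHom.ext (algebraMap_germ f U (g y) hyU)
  refine ⟨ψ, hψsurj, ?_, ?_⟩
  · rw [hψker, hκf, ker_stalkMap_eq g hU y hyU, Ideal.map_map, Ideal.map_map, hgerm]
  · let := S.presheaf.algebra_section_stalk ⟨g y, hyU⟩
    have := hU.isLocalization_stalk ⟨g y, hyU⟩
    refine IsLocalization.ringHom_ext (hU.primeIdealOf ⟨g y, hyU⟩).asIdeal.primeCompl
      (RingHom.ext fun c ↦ ?_)
    calc ψ (algebraMap _ _ (S.presheaf.germ U (g y) hyU c))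
      _ = ψ (pushforwardGerm f U (g y) hyU (f.app U c)) := congr_arg ψ congr($hgerm c)
      _ = pushforwardGerm l (g ⁻¹ᵁ U) y hyU
          (k.appLE _ _ (preimage_preimage_eq_of_isPullback H U).le (f.app U c)) :=
        congr($hψ (f.app U c))
      _ = pushforwardGerm l (g ⁻¹ᵁ U) y hyU (l.app (g ⁻¹ᵁ U) (g.app U c)) :=
        congr_arg (pushforwardGerm l _ y hyU) congr($(app_comp_appLE_of_isPullback H U) c)
      _ = algebraMap _ _ (T.presheaf.germ (g ⁻¹ᵁ U) y hyU (g.app U c)) :=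
        (algebraMap_germ l (g ⁻¹ᵁ U) y hyU _).symm
      _ = algebraMap _ _ (g.stalkMap y (S.presheaf.germ U (g y) hyU c)) :=
        congr_arg _ (Scheme.Hom.germ_stalkMap_apply ..).symm

end

end Fibre

section StructureHom

variable {R K : Type u} [CommRing R] [CommRing K] {X Y : Scheme.{u}} (q : Y ⟶ Spec (.of R))

/-- The structure homomorphism `R → Γ(Y, U)` of a scheme `q : Y ⟶ Spec R` over `R`. -/
def structureHom (U : Y.Opens) : R →+* Γ(Y, U) :=
  ((Scheme.ΓSpecIso (.of R)).inv ≫ q.appLE ⊤ U (show U ≤ q ⁻¹ᵁ ⊤ from le_top)).hom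

/-- The structure homomorphism `R → 𝒪_{Y,y}` of a scheme `q : Y ⟶ Spec R` over `R`. -/
def stalkStructureHom (y : Y) : R →+* Y.presheaf.stalk y :=
  (Y.presheaf.germ ⊤ y trivial).hom.comp (structureHom q ⊤)

lemma germ_comp_structureHom (U : Y.Opens) (y : Y) (hy : y ∈ U) :
    (Y.presheaf.germ U y hy).hom.comp (structureHom q U) = stalkStructureHom q y := by
  rw [stalkStructureHom, structureHom, structureHom, ← CommRingCat.hom_comp,
    ← CommRingCat.hom_comp, Category.assoc, Category.assoc,
    ← Y.presheaf.germ_res (homOfLE le_top : U ⟶ ⊤) y hy, Scheme.Hom.appLE_map_assoc]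

lemma app_comp_structureHom (i : X ⟶ Y) (U : Y.Opens) :
    (i.app U).hom.comp (structureHom q U) = structureHom (i ≫ q) (i ⁻¹ᵁ U) := by
  rw [structureHom, structureHom, ← CommRingCat.hom_comp, Category.assoc,
    Scheme.Hom.app_eq_appLE, Scheme.Hom.appLE_comp_appLE]

lemma flat_structureHom [Flat q] {U : Y.Opens} (hU : IsAffineOpen U) : (structureHom q U).Flat :=
  (RingHom.Flat.of_bijective
    (ConcreteCategory.bijective_of_isIso (Scheme.ΓSpecIso (.of R)).inv)).comp
    (HasRingHomProperty.appLE @Flat q ‹_› ⟨⊤, isAffineOpen_top _⟩ ⟨U, hU⟩ le_top)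

lemma flat_algebraMap_comp_stalkStructureHom (i : X ⟶ Y) [IsAffineHom i] [Flat (i ≫ q)] (y : Y) :
    ((algebraMap (Y.presheaf.stalk y) (PushforwardStalk i y)).comp
      (stalkStructureHom q y)).Flat := by
  obtain ⟨_, ⟨U, hU, rfl⟩, hyU, -⟩ :=
    Y.isBasis_affineOpens.exists_subset_of_mem_open (Set.mem_univ y) isOpen_univ
  let := (pushforwardGerm i U y hyU).toAlgebra
  have := isLocalization_pushforwardGerm i hU y hyU
  have hgerm : (algebraMap _ (PushforwardStalk i y)).comp (Y.presheaf.germ U y hyU).hom =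
      (pushforwardGerm i U y hyU).comp (i.app U).hom :=
    RingHom.ext (algebraMap_germ i U y hyU)
  rw [← germ_comp_structureHom q U y hyU, ← RingHom.comp_assoc, hgerm, RingHom.comp_assoc,
    app_comp_structureHom]
  exact (flat_structureHom (i ≫ q) (hU.preimage i)).comp
    (IsLocalization.flat (PushforwardStalk i y)
      ((hU.primeIdealOf ⟨y, hyU⟩).asIdeal.primeCompl.map (i.app U).hom))

lemma finite_pushforwardStalk (i : X ⟶ Y) [IsFinite i] (y : Y) :
    Module.Finite (Y.presheaf.stalk y) (PushforwardStalk i y) := by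
  obtain ⟨_, ⟨U, hU, rfl⟩, hyU, -⟩ :=
    Y.isBasis_affineOpens.exists_subset_of_mem_open (Set.mem_univ y) isOpen_univ
  let M := (hU.primeIdealOf ⟨y, hyU⟩).asIdeal.primeCompl
  let := (i.app U).hom.toAlgebra
  let := Y.presheaf.algebra_section_stalk ⟨y, hyU⟩
  let := (pushforwardGerm i U y hyU).toAlgebra
  let := ((pushforwardGerm i U y hyU).comp (i.app U).hom).toAlgebra
  have : IsScalarTower Γ(Y, U) Γ(X, i ⁻¹ᵁ U) (PushforwardStalk i y) := .of_algebraMap_eq' rfl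
  have : IsScalarTower Γ(Y, U) (Y.presheaf.stalk y) (PushforwardStalk i y) :=
    .of_algebraMap_eq fun c ↦ (algebraMap_germ i U y hyU c).symm
  have : IsLocalization M (Y.presheaf.stalk y) := hU.isLocalization_stalk ⟨y, hyU⟩
  have : IsLocalization (Algebra.algebraMapSubmonoid Γ(X, i ⁻¹ᵁ U) M) (PushforwardStalk i y) :=
    isLocalization_pushforwardGerm i hU y hyU
  have : Module.Finite Γ(Y, U) Γ(X, i ⁻¹ᵁ U) := i.finite_app U hU
  exact .of_isLocalization Γ(Y, U) Γ(X, i ⁻¹ᵁ U) M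

variable {θ : R →+* K} (hθ : Function.Surjective θ)

include hθ

lemma app_fibreInclusion_surjective_and_ker_eq {U : Y.Opens} (hU : IsAffineOpen U) :
    Function.Surjective ((pullback.fst q (Spec.map (CommRingCat.ofHom θ))).app U) ∧
      RingHom.ker ((pullback.fst q (Spec.map (CommRingCat.ofHom θ))).app U).hom =
        (RingHom.ker θ).map (structureHom q U) := by
  obtain ⟨hs, hk⟩ := Spec_map_app_top_surjective_and_ker_eq (CommRingCat.ofHom θ) hθ
  have := appLE_surjective_and_ker_eq (.of_hasPullback q (Spec.map (CommRingCat.ofHom θ)))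
    (isAffineOpen_top _) hs hU
    (show U ≤ q ⁻¹ᵁ ⊤ from le_top) rfl
  rwa [hk, Ideal.map_map, ← Scheme.Hom.app_eq_appLE] at this

lemma ker_stalkMap_fibreInclusion (y : ↥(pullback q (Spec.map (CommRingCat.ofHom θ)))) :
    RingHom.ker ((pullback.fst q (Spec.map (CommRingCat.ofHom θ))).stalkMap y).hom =
      (RingHom.ker θ).map (stalkStructureHom q _) := by
  have : IsClosedImmersion (Spec.map (CommRingCat.ofHom θ)) := .spec_of_surjective _ hθ
  obtain ⟨_, ⟨U, hU, rfl⟩, hyU, -⟩ := Y.isBasis_affineOpens.exists_subset_of_mem_open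
    (Set.mem_univ (pullback.fst q (Spec.map (CommRingCat.ofHom θ)) y)) isOpen_univ
  rw [ker_stalkMap_eq _ hU y hyU, (app_fibreInclusion_surjective_and_ker_eq q hθ hU).2,
    Ideal.map_map, germ_comp_structureHom]

end StructureHom

section Presentation

theorem exists_presentation_of_isPullback {R : Type u} [CommRing R] {X Y T X' : Scheme.{u}}
    (q : Y ⟶ Spec (.of R)) {i : X ⟶ Y} {j : T ⟶ Y} {k : X' ⟶ X} {i' : X' ⟶ T}
    (H : IsPullback k i' i j) [IsFinite i] [Flat (i ≫ q)] [IsClosedImmersion j] (y : T)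
    [IsNoetherianRing (Y.presheaf.stalk (j y))] {I : Ideal R}
    (hI : RingHom.ker (j.stalkMap y).hom = I.map (stalkStructureHom q (j y)))
    {v' : PushforwardStalk i' y} (hv' : Function.Surjective (pairMap (T.presheaf.stalk y) v'))
    {ι : Type*} {r' : ι → Fin 2 → T.presheaf.stalk y}
    (hr' : Submodule.span _ (Set.range r') = LinearMap.ker (pairMap (T.presheaf.stalk y) v')) :
    ∃ v : PushforwardStalk i (j y),
      Function.Surjective (pairMap (Y.presheaf.stalk (j y)) v) ∧
        ∃ r : ι → Fin 2 → Y.presheaf.stalk (j y),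
          Submodule.span _ (Set.range r) = LinearMap.ker (pairMap _ v) := by
  obtain ⟨ψ, hψ, hψker, hψcomp⟩ := exists_pushforwardStalk_ringHom j H y
  let : Algebra R (Y.presheaf.stalk (j y)) := (stalkStructureHom q (j y)).toAlgebra
  let : Algebra R (PushforwardStalk i (j y)) :=
    ((algebraMap _ _).comp (stalkStructureHom q (j y))).toAlgebra
  have : IsScalarTower R (Y.presheaf.stalk (j y)) (PushforwardStalk i (j y)) :=
    .of_algebraMap_eq' rfl
  have : Module.Flat R (PushforwardStalk i (j y)) :=
    flat_algebraMap_comp_stalkStructureHom q i (j y)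
  have := finite_pushforwardStalk i (j y)
  have hlocal : RingHom.ker (j.stalkMap y).hom ≤ Ideal.jacobson ⊥ :=
    (le_maximalIdeal (RingHom.ker_ne_top _)).trans (maximalIdeal_le_jacobson ⊥)
  exact exists_presentation_of_reduction (j.stalkMap_surjective y) hI hlocal hψ hψker
    (RingHom.congr_fun hψcomp) hv' hr'

end Presentation

section Chart

open TopologicalSpace Opposite HomogeneousLocalization

attribute [local instance] MvPolynomial.gradedAlgebra

variable (n : ℕ) (R : Type u) [CommRing R]

/-- The standard affine chart `D₊(x_k)` of projective space. -/
abbrev chart (k : Fin (n + 1)) : (ProjSpace n R).Opens :=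
  Proj.basicOpen (MvPolynomial.homogeneousSubmodule (Fin (n + 1)) R) (MvPolynomial.X k)

lemma X_mem_homogeneousSubmodule (k : Fin (n + 1)) :
    (MvPolynomial.X k : MvPolynomial (Fin (n + 1)) R) ∈
      MvPolynomial.homogeneousSubmodule (Fin (n + 1)) R 1 :=
  MvPolynomial.isHomogeneous_X R k

lemma isAffineOpen_chart (k : Fin (n + 1)) : IsAffineOpen (chart n R k) :=
  Proj.isAffineOpen_basicOpen _ _ (X_mem_homogeneousSubmodule n R k) one_pos

lemma algebraMap_zero_surjective :
    Function.Surjective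
      (algebraMap R (MvPolynomial.homogeneousSubmodule (Fin (n + 1)) R 0)) := by
  rintro ⟨p, hp⟩
  have hdeg : p.totalDegree = 0 := Nat.le_zero.1 (MvPolynomial.IsHomogeneous.totalDegree_le hp)
  exact ⟨_, Subtype.ext (MvPolynomial.totalDegree_eq_zero_iff_eq_C.1 hdeg).symm⟩

lemma adjoin_range_X :
    Algebra.adjoin (MvPolynomial.homogeneousSubmodule (Fin (n + 1)) R 0)
      (Set.range (MvPolynomial.X : Fin (n + 1) → MvPolynomial (Fin (n + 1)) R)) = ⊤ := by
  refine eq_top_iff.2 fun p _ ↦ ?_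
  induction p using MvPolynomial.induction_on with
  | C r =>
    exact Subalgebra.algebraMap_mem _
      (algebraMap R (MvPolynomial.homogeneousSubmodule (Fin (n + 1)) R 0) r)
  | add p q hp hq => exact add_mem (hp trivial) (hq trivial)
  | mul_X p l hp => exact mul_mem (hp trivial) (Algebra.subset_adjoin ⟨l, rfl⟩)

lemma exists_mem_chart (y : ProjSpace n R) : ∃ k, y ∈ chart n R k := by
  have := Proj.iSup_basicOpen_eq_top' (MvPolynomial.homogeneousSubmodule (Fin (n + 1)) R)
    (MvPolynomial.X : Fin (n + 1) → MvPolynomial (Fin (n + 1)) R)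
    (fun k ↦ ⟨1, X_mem_homogeneousSubmodule n R k⟩) (adjoin_range_X n R)
  exact Opens.mem_iSup.1 (this ▸ Opens.mem_top y)

/-- The structure homomorphism `R → R[x₀, …, xₙ]_(x_k)` of the coordinate ring of a standard
chart. -/
def toAway (k : Fin (n + 1)) :
    R →+* Away (MvPolynomial.homogeneousSubmodule (Fin (n + 1)) R) (MvPolynomial.X k) :=
  (fromZeroRingHom (MvPolynomial.homogeneousSubmodule (Fin (n + 1)) R)
    (Submonoid.powers (MvPolynomial.X k))).comp
      (algebraMap R (MvPolynomial.homogeneousSubmodule (Fin (n + 1)) R 0))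

/-- The affine coordinate `x_l / x_k` of a standard chart. -/
def coordinate (k l : Fin (n + 1)) :
    Away (MvPolynomial.homogeneousSubmodule (Fin (n + 1)) R) (MvPolynomial.X k) :=
  Away.mk _ (X_mem_homogeneousSubmodule n R k) 1 (MvPolynomial.X l)
    (X_mem_homogeneousSubmodule n R _)

lemma val_coordinate (k l : Fin (n + 1)) :
    (coordinate n R k l).val = Localization.mk (MvPolynomial.X l)
      (⟨MvPolynomial.X k ^ 1, 1, rfl⟩ : Submonoid.powers (MvPolynomial.X k)) :=
  Away.val_mk ..

/-- The homomorphism from the polynomial ring in `n` variables to the coordinate ring of a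
standard chart which sends the variables to the affine coordinates. -/
def affineCoordinates (k : Fin (n + 1)) : MvPolynomial (Fin n) R →+*
    Away (MvPolynomial.homogeneousSubmodule (Fin (n + 1)) R) (MvPolynomial.X k) :=
  MvPolynomial.eval₂Hom (toAway n R k) fun l ↦ coordinate n R k (k.succAbove l)

lemma coordinate_mem_range_affineCoordinates (k l : Fin (n + 1)) :
    coordinate n R k l ∈ (affineCoordinates n R k).range := by
  rcases Fin.eq_self_or_eq_succAbove k l with rfl | ⟨l, rfl⟩
  · convert one_mem (affineCoordinates n R l).range
    ext
    simp [coordinate]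
  · exact ⟨MvPolynomial.X l, by simp [affineCoordinates]⟩

lemma adjoin_range_coordinate (k : Fin (n + 1)) :
    Algebra.adjoin (MvPolynomial.homogeneousSubmodule (Fin (n + 1)) R 0)
      (Set.range (coordinate n R k)) = ⊤ := by
  let 𝒜 := MvPolynomial.homogeneousSubmodule (Fin (n + 1)) R
  have hX := X_mem_homogeneousSubmodule n R
  rw [eq_top_iff, ← Away.adjoin_mk_prod_pow_eq_top (𝒜 := 𝒜) (hX k) (Fin (n + 1))
    MvPolynomial.X (adjoin_range_X n R) (fun _ ↦ 1) hX, Algebra.adjoin_le_iff]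
  rintro _ ⟨a, e, ha, -, rfl⟩
  have hprod : Away.mk 𝒜 (hX k) a (∏ l, MvPolynomial.X l ^ e l)
      (ha ▸ SetLike.prod_pow_mem_graded _ _ _ _ fun l _ ↦ hX l) =
      ∏ l, coordinate n R k l ^ e l := by
    apply (show Function.Injective (algebraMap (Away 𝒜 (MvPolynomial.X k))
      (Localization.Away (MvPolynomial.X k : MvPolynomial (Fin (n + 1)) R)))
      from val_injective _)
    simp only [smul_eq_mul, mul_one] at ha
    simp only [map_pow, map_prod]
    simp only [HomogeneousLocalization.algebraMap_apply, Away.val_mk, val_coordinate,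
      Localization.mk_pow, Localization.mk_prod]
    congr 1
    ext
    simp [Finset.prod_pow_eq_pow_sum, ha]
  rw [hprod]
  exact prod_mem fun l _ ↦ pow_mem (Algebra.subset_adjoin (Set.mem_range_self l)) _

lemma affineCoordinates_surjective (k : Fin (n + 1)) :
    Function.Surjective (affineCoordinates n R k) := by
  let S : Subalgebra (MvPolynomial.homogeneousSubmodule (Fin (n + 1)) R 0)
      (Away (MvPolynomial.homogeneousSubmodule (Fin (n + 1)) R) (MvPolynomial.X k)) :=
    { (affineCoordinates n R k).range with
      algebraMap_mem' := fun c ↦ by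
        obtain ⟨r, rfl⟩ := algebraMap_zero_surjective n R c
        exact ⟨MvPolynomial.C r, MvPolynomial.eval₂Hom_C _ _ r⟩ }
  have hS : S = ⊤ := by
    rw [eq_top_iff, ← adjoin_range_coordinate, Algebra.adjoin_le_iff]
    exact Set.range_subset_iff.2 (coordinate_mem_range_affineCoordinates n R k)
  exact fun z ↦ (hS ▸ Algebra.mem_top : z ∈ S)

lemma structureHom_chart (k : Fin (n + 1)) :
    structureHom (ProjSpace.toSpec n R) (chart n R k) =
      (Proj.awayToSection (MvPolynomial.homogeneousSubmodule (Fin (n + 1)) R)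
        (MvPolynomial.X k)).hom.comp (toAway n R k) := by
  let 𝒜 := MvPolynomial.homogeneousSubmodule (Fin (n + 1)) R
  have hι : (chart n R k).ι ≫ ProjSpace.toSpec n R =
      Proj.basicOpenToSpec 𝒜 (MvPolynomial.X k) ≫
        Spec.map (CommRingCat.ofHom (toAway n R k)) := by
    have := Proj.awayι_toSpecZero 𝒜 (MvPolynomial.X k) (X_mem_homogeneousSubmodule n R k) one_pos
    rw [Proj.awayι, Category.assoc, Iso.inv_comp_eq, Proj.basicOpenIsoSpec_hom] at this
    rw [ProjSpace.toSpec, ← Category.assoc, this, Category.assoc, ← Spec.map_comp]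
    rfl
  have hres : ((chart n R k).ι ≫ ProjSpace.toSpec n R).appTop ≫ (chart n R k).topIso.hom =
      (ProjSpace.toSpec n R).appLE ⊤ (chart n R k)
        (show chart n R k ≤ ProjSpace.toSpec n R ⁻¹ᵁ ⊤ from le_top) := by
    have h : (chart n R k).ι.appTop ≫ (chart n R k).topIso.hom =
        (ProjSpace n R).presheaf.map (homOfLE le_top).op := by
      rw [Scheme.Opens.topIso_hom, Scheme.Opens.ι_appTop]
      exact ((ProjSpace n R).presheaf.map_comp _ _).symm
    rw [Scheme.Hom.comp_appTop, Category.assoc, h]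
    rfl
  have htop : (Proj.basicOpenToSpec 𝒜 (MvPolynomial.X k)).appTop =
      (Scheme.ΓSpecIso _).hom ≫ Proj.awayToSection 𝒜 (MvPolynomial.X k) ≫
        (chart n R k).topIso.inv :=
    Proj.basicOpenToSpec_app_top 𝒜 (MvPolynomial.X k)
  refine congr_arg CommRingCat.Hom.hom (?_ : (Scheme.ΓSpecIso (CommRingCat.of R)).inv ≫
    (ProjSpace.toSpec n R).appLE ⊤ (chart n R k) le_top = CommRingCat.ofHom (toAway n R k) ≫
      Proj.awayToSection 𝒜 (MvPolynomial.X k))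
  rw [← hres, hι, Scheme.Hom.comp_appTop, htop]
  simp only [Category.assoc, Iso.inv_hom_id, Category.comp_id,
    Scheme.ΓSpecIso_naturality_assoc, Iso.inv_hom_id_assoc]

lemma exists_mvPolynomial_surjective_chart (k : Fin (n + 1)) :
    ∃ τ : MvPolynomial (Fin n) R →+* Γ(ProjSpace n R, chart n R k), Function.Surjective τ ∧
      τ.comp MvPolynomial.C = structureHom (ProjSpace.toSpec n R) (chart n R k) := by
  let 𝒜 := MvPolynomial.homogeneousSubmodule (Fin (n + 1)) R
  have hiso : Function.Surjective (Proj.awayToSection 𝒜 (MvPolynomial.X k)) :=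
    (ConcreteCategory.bijective_of_isIso (Proj.basicOpenIsoAway 𝒜 (MvPolynomial.X k)
      (X_mem_homogeneousSubmodule n R k) one_pos).hom).2
  refine ⟨(Proj.awayToSection 𝒜 (MvPolynomial.X k)).hom.comp (affineCoordinates n R k),
    hiso.comp (affineCoordinates_surjective n R k), ?_⟩
  rw [structureHom_chart, RingHom.comp_assoc, affineCoordinates, MvPolynomial.eval₂Hom_comp_C]

instance isNoetherianRing_chart [IsNoetherianRing R] (k : Fin (n + 1)) :
    IsNoetherianRing Γ(ProjSpace n R, chart n R k) :=
  have ⟨τ, hτ, _⟩ := exists_mvPolynomial_surjective_chart n R k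
  isNoetherianRing_of_surjective _ _ τ hτ

instance isNoetherianRing_stalk [IsNoetherianRing R] (y : ProjSpace n R) :
    IsNoetherianRing ((ProjSpace n R).presheaf.stalk y) := by
  obtain ⟨k, hk⟩ := exists_mem_chart n R y
  let := (ProjSpace n R).presheaf.algebra_section_stalk ⟨y, hk⟩
  have := (isAffineOpen_chart n R k).isLocalization_stalk ⟨y, hk⟩
  exact IsLocalization.isNoetherianRing
    ((isAffineOpen_chart n R k).primeIdealOf ⟨y, hk⟩).asIdeal.primeCompl _ inferInstance

instance locallyOfFiniteType_toSpec : LocallyOfFiniteType (ProjSpace.toSpec n R) := by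
  have : Algebra.FiniteType (MvPolynomial.homogeneousSubmodule (Fin (n + 1)) R 0)
      (MvPolynomial (Fin (n + 1)) R) :=
    ⟨Subalgebra.fg_def.2 ⟨_, Set.finite_range MvPolynomial.X, adjoin_range_X n R⟩⟩
  have : IsClosedImmersion (Spec.map (CommRingCat.ofHom
      (algebraMap R (MvPolynomial.homogeneousSubmodule (Fin (n + 1)) R 0)))) :=
    .spec_of_surjective _ (algebraMap_zero_surjective n R)
  exact inferInstanceAs (LocallyOfFiniteType (_ ≫ _))

lemma exists_mvPolynomial_surjective_fibre {R K : Type u} [CommRing R] [CommRing K] {θ : R →+* K}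
    (hθ : Function.Surjective θ) (k : Fin (n + 1)) :
    ∃ τ : MvPolynomial (Fin n) K →+*
      Γ(fibreSpace n (Spec.map (CommRingCat.ofHom θ)),
        fibreSpaceMap n (Spec.map (CommRingCat.ofHom θ)) ⁻¹ᵁ chart n R k),
      Function.Surjective τ := by
  obtain ⟨τ, hτ, hτC⟩ := exists_mvPolynomial_surjective_chart n R k
  obtain ⟨hs, hk⟩ := app_fibreInclusion_surjective_and_ker_eq (ProjSpace.toSpec n R) hθ
    (isAffineOpen_chart n R k)
  let σ := ((fibreSpaceMap n (Spec.map (CommRingCat.ofHom θ))).app (chart n R k)).hom.comp τ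
  have hmap := MvPolynomial.map_surjective (σ := Fin n) θ hθ
  have hle : RingHom.ker (MvPolynomial.map (σ := Fin n) θ) ≤ RingHom.ker σ := by
    rw [MvPolynomial.ker_map, ← RingHom.comap_ker, hk, ← hτC, ← Ideal.map_map]
    exact Ideal.le_comap_map
  refine ⟨RingHom.liftOfSurjective _ hmap ⟨σ, hle⟩, fun c ↦ ?_⟩
  obtain ⟨p, rfl⟩ := (hs.comp hτ) c
  exact ⟨MvPolynomial.map θ p, RingHom.liftOfRightInverse_comp_apply _ _
    (Function.rightInverse_surjInv hmap) ⟨σ, hle⟩ p⟩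

end Chart

section LocalRing

lemma spanFinrank_maximalIdeal_le_height {S C A : Type*} [CommRing S] [IsRegularRing S]
    [CommRing C] [CommRing A] [Algebra C A] [IsLocalRing A] {τ : S →+* C}
    (hτ : Function.Surjective τ) (p : Ideal C) [p.IsPrime] [IsLocalization.AtPrime A p] :
    (maximalIdeal A).spanFinrank ≤ (p.comap τ).height := by
  let S' := Localization.AtPrime (p.comap τ)
  let σ : S' →+* A :=
    IsLocalization.map A τ (M := (p.comap τ).primeCompl) (T := p.primeCompl) fun _ h ↦ h
  have hσ : σ.comp (algebraMap S S') = (algebraMap C A).comp τ := IsLocalization.map_comp _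
  have hmap : (maximalIdeal S').map σ = maximalIdeal A := by
    rw [← IsLocalization.AtPrime.map_eq_maximalIdeal (p.comap τ) S', Ideal.map_map,
      hσ, ← Ideal.map_map, Ideal.map_comap_of_surjective τ hτ,
      IsLocalization.AtPrime.map_eq_maximalIdeal p A]
  have hle : (maximalIdeal A).spanFinrank ≤ (maximalIdeal S').spanFinrank :=
    hmap ▸ Ideal.spanFinrank_map_le_of_fg σ (IsNoetherian.noetherian _)
  have hS' : ((maximalIdeal S').spanFinrank : ℕ∞) = (p.comap τ).height := by
    rw [← WithBot.coe_inj, ← IsLocalization.AtPrime.ringKrullDim_eq_height (p.comap τ) S']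
    exact IsRegularLocalRing.spanFinrank_maximalIdeal
  exact (Nat.cast_le.2 hle).trans hS'.le

section MvPolynomial

variable {K : Type*} [Field K] {n : ℕ} {p : Ideal (MvPolynomial (Fin n) K)}

lemma height_le_of_ne_top (hp : p ≠ ⊤) : p.height ≤ n := by
  have := p.height_le_ringKrullDim_of_ne_top hp
  rw [MvPolynomial.ringKrullDim_of_isNoetherianRing, ringKrullDim_eq_zero_of_field, Nat.card_fin,
    zero_add] at this
  exact WithBot.coe_le_coe.1 this

lemma height_lt_of_not_isMaximal [p.IsPrime] (hp : ¬ p.IsMaximal) : p.height < n := by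
  obtain ⟨m, hm, hpm⟩ := p.exists_le_maximal Ideal.IsPrime.ne_top'
  have hlt : p < m := hpm.lt_of_ne fun h ↦ hp (h ▸ hm)
  exact (Ideal.height_strict_mono_of_isPrime_of_isPrime hlt).trans_le
    (height_le_of_ne_top hm.ne_top)

end MvPolynomial

variable {K C A : Type*} [Field K] {n : ℕ} [CommRing C] {τ : MvPolynomial (Fin n) K →+* C}
  (hτ : Function.Surjective τ) (p : Ideal C) [p.IsPrime] [CommRing A] [Algebra C A] [IsLocalRing A]
  [IsLocalization.AtPrime A p]

include hτ p in
lemma spanFinrank_maximalIdeal_le_of_mvPolynomial : (maximalIdeal A).spanFinrank ≤ n :=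
  Nat.cast_le.1 <| (spanFinrank_maximalIdeal_le_height hτ p).trans
    (height_le_of_ne_top (Ideal.comap_ne_top τ Ideal.IsPrime.ne_top'))

include hτ p in
lemma spanFinrank_maximalIdeal_lt_of_mvPolynomial (hp : ¬ p.IsMaximal) :
    (maximalIdeal A).spanFinrank < n := by
  have hcomap : ¬ (p.comap τ).IsMaximal := fun h ↦ hp <| by
    have := Ideal.map_eq_top_or_isMaximal_of_surjective τ hτ h
    rw [Ideal.map_comap_of_surjective τ hτ] at this
    exact this.resolve_left Ideal.IsPrime.ne_top'
  exact Nat.cast_lt.1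
    ((spanFinrank_maximalIdeal_le_height hτ p).trans_lt (height_lt_of_not_isMaximal hcomap))

end LocalRing

section Depth

open Module.associatedPrimes in
lemma maximalIdeal_mem_associatedPrimes_iff {C A M N : Type*} [CommRing C] [IsNoetherianRing C]
    [CommRing A] [Algebra C A] [IsLocalRing A] (p : Ideal C) [p.IsPrime]
    [IsLocalization.AtPrime A p] [AddCommGroup M] [Module C M] [AddCommGroup N] [Module C N]
    [Module A N] [IsScalarTower C A N] (f : M →ₗ[C] N) [IsLocalizedModule p.primeCompl f] :
    maximalIdeal A ∈ associatedPrimes A N ↔ p ∈ associatedPrimes C M := by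
  rw [← preimage_comap_associatedPrimes_eq_associatedPrimes_of_isLocalizedModule
    p.primeCompl A f, Set.mem_preimage]
  simp only [IsLocalization.AtPrime.under_maximalIdeal A p]

lemma exists_mem_associatedPrimes_comap_eq {C E : Type*} [CommRing C] [IsNoetherianRing C]
    [CommRing E] [IsNoetherianRing E] [Algebra C E] {p : Ideal C} (hp : p ∈ associatedPrimes C E) :
    ∃ q ∈ associatedPrimes E E, q.comap (algebraMap C E) = p := by
  obtain ⟨hp, e, hpe⟩ := isAssociatedPrime_iff.1 hp
  have hcomap : p = ((⊥ : Submodule E E).colon {e}).comap (algebraMap C E) := by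
    ext c
    rw [hpe, Ideal.mem_comap, Submodule.mem_colon_singleton, Submodule.mem_colon_singleton,
      algebraMap_smul, Submodule.mem_bot, Submodule.mem_bot]
  have hmin : p ∈ (((⊥ : Submodule E E).colon {e}).comap (algebraMap C E)).minimalPrimes := by
    rw [← hcomap, Ideal.minimalPrimes_eq_subsingleton_self, Set.mem_singleton_iff]
  obtain ⟨q, hq, hqp⟩ := Ideal.exists_minimalPrimes_comap_eq _ p hmin
  exact ⟨q, isAssociatedPrime_iff.2
    ⟨hq.isPrime, Submodule.exists_eq_colon_of_mem_minimalPrimes hq⟩, hqp⟩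

lemma IsCohenMacaulayLocalRing.maximalIdeal_notMem_associatedPrimes {A : Type u} [CommRing A]
    [IsLocalRing A] (hA : IsCohenMacaulayLocalRing A) (hdim : ringKrullDim A ≠ 0) :
    maximalIdeal A ∉ associatedPrimes A A := by
  obtain ⟨hnoeth, _ | ⟨r, rs⟩, hrs, hreg, hlen⟩ := hA
  · exact absurd hlen.symm hdim
  · intro h
    have hr : r ∈ ⋃ p ∈ associatedPrimes A A, (p : Set A) :=
      Set.mem_biUnion h (hrs r List.mem_cons_self)
    rw [biUnion_associatedPrimes_eq_compl_regular] at hr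
    exact hr ((RingTheory.Sequence.isRegular_cons_iff _ _ _).1 hreg).1

lemma IsPureDimOne.ringKrullDim_stalk_ne_zero {X : Scheme.{u}} (hX : IsPureDimOne X) {x : X}
    (hx : IsClosed {x}) : ringKrullDim (X.presheaf.stalk x) ≠ 0 := by
  rw [ringKrullDim_stalk_eq_coheight, Ne, WithBot.coe_eq_zero, Order.coheight_eq_zero]
  intro hmax
  have hZ := irreducibleComponent_mem_irreducibleComponents x
  obtain ⟨z, hz⟩ := QuasiSober.sober hZ.1 (isClosed_of_mem_irreducibleComponents _ hZ)
  have hxz : x = z :=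
    have hzx : z ⤳ x := hz.specializes mem_irreducibleComponent
    have hxz : x ⤳ z := hmax hzx
    (hxz.antisymm hzx).eq
  have hdim := hX _ hZ
  rw [← hz.def, ← hxz, hx.closure_eq] at hdim
  exact absurd (hdim ▸ topologicalKrullDim_zero_of_discreteTopology ({x} : Set X)) (by decide)

lemma isClosed_singleton_fromSpec {X : Scheme.{u}} [JacobsonSpace X] {W : X.Opens}
    (hW : IsAffineOpen W) {Q : Spec Γ(X, W)} (hQ : Q.asIdeal.IsMaximal) :
    IsClosed {hW.fromSpec Q} := by
  have hQ' : IsClosed {Q} := (PrimeSpectrum.isClosed_singleton_iff_isMaximal Q).2 hQ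
  have hemb := hW.fromSpec.isOpenEmbedding
  refine isClosed_singleton_of_isLocallyClosed_singleton ?_
  rw [← Set.image_singleton]
  exact hQ'.isLocallyClosed.image hemb.isInducing hemb.isOpen_range.isLocallyClosed

lemma notMem_associatedPrimes_of_isMaximal {X : Scheme.{u}} [JacobsonSpace X]
    (hCM : IsCohenMacaulayScheme X) (hdim : IsPureDimOne X) {W : X.Opens} (hW : IsAffineOpen W)
    {q : Ideal Γ(X, W)} (hq : q.IsMaximal) : q ∉ associatedPrimes Γ(X, W) Γ(X, W) := by
  let Q : Spec Γ(X, W) := ⟨q, hq.isPrime⟩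
  have hxW : hW.fromSpec Q ∈ W := hW.range_fromSpec.le (Set.mem_range_self Q)
  let : Algebra Γ(X, W) (X.presheaf.stalk (hW.fromSpec Q)) :=
    X.presheaf.algebra_section_stalk ⟨hW.fromSpec Q, hxW⟩
  have : IsLocalization.AtPrime (X.presheaf.stalk (hW.fromSpec Q)) q :=
    hW.isLocalization_stalk' Q hxW
  have := hCM.1
  have : IsNoetherianRing Γ(X, W) := IsLocallyNoetherian.component_noetherian ⟨W, hW⟩
  rw [← maximalIdeal_mem_associatedPrimes_iff (A := X.presheaf.stalk (hW.fromSpec Q)) q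
    (Algebra.linearMap Γ(X, W) (X.presheaf.stalk (hW.fromSpec Q)))]
  exact (hCM.2 _).maximalIdeal_notMem_associatedPrimes
    (hdim.ringKrullDim_stalk_ne_zero (isClosed_singleton_fromSpec hW hq))

theorem maximalIdeal_notMem_associatedPrimes_pushforwardStalk {X Y : Scheme.{u}} (i : X ⟶ Y)
    [IsFinite i] [JacobsonSpace X] (hCM : IsCohenMacaulayScheme X) (hdim : IsPureDimOne X)
    {U : Y.Opens} (hU : IsAffineOpen U) [IsNoetherianRing Γ(Y, U)] {y : Y} (hy : y ∈ U)
    (hmax : (hU.primeIdealOf ⟨y, hy⟩).asIdeal.IsMaximal) :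
    maximalIdeal (Y.presheaf.stalk y) ∉
      associatedPrimes (Y.presheaf.stalk y) (PushforwardStalk i y) := by
  let p := (hU.primeIdealOf ⟨y, hy⟩).asIdeal
  let B := PushforwardStalk i y
  let : Algebra Γ(Y, U) (Y.presheaf.stalk y) := Y.presheaf.algebra_section_stalk ⟨y, hy⟩
  let : Algebra Γ(X, i ⁻¹ᵁ U) B := (pushforwardGerm i U y hy).toAlgebra
  let : Algebra Γ(Y, U) Γ(X, i ⁻¹ᵁ U) := (i.app U).hom.toAlgebra
  let : Algebra Γ(Y, U) B := ((pushforwardGerm i U y hy).comp (i.app U).hom).toAlgebra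
  have : IsScalarTower Γ(Y, U) Γ(X, i ⁻¹ᵁ U) B := .of_algebraMap_eq' rfl
  have : IsScalarTower Γ(Y, U) (Y.presheaf.stalk y) B :=
    .of_algebraMap_eq fun c ↦ (algebraMap_germ i U y hy c).symm
  have : Module.Finite Γ(Y, U) Γ(X, i ⁻¹ᵁ U) := i.finite_app U hU
  have : IsNoetherianRing Γ(X, i ⁻¹ᵁ U) := IsNoetherianRing.of_finite Γ(Y, U) _
  have : IsLocalization.AtPrime (Y.presheaf.stalk y) p := hU.isLocalization_stalk ⟨y, hy⟩
  have : IsLocalizedModule p.primeCompl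
      (IsScalarTower.toAlgHom Γ(Y, U) Γ(X, i ⁻¹ᵁ U) B).toLinearMap :=
    isLocalizedModule_iff_isLocalization.2 (isLocalization_pushforwardGerm i hU y hy)
  rw [maximalIdeal_mem_associatedPrimes_iff p
    (IsScalarTower.toAlgHom Γ(Y, U) Γ(X, i ⁻¹ᵁ U) B).toLinearMap]
  intro hp
  obtain ⟨q, hq, hqp⟩ := exists_mem_associatedPrimes_comap_eq hp
  have := hq.isPrime
  refine notMem_associatedPrimes_of_isMaximal hCM hdim (hU.preimage i) ?_ hq
  refine Ideal.isMaximal_of_isIntegral_of_isMaximal_comap (R := Γ(Y, U)) q ?_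
  rw [hqp]
  exact hmax

end Depth

section SchematicImage

variable {X Y : Scheme.{u}} (i : X ⟶ Y) (η : i.image)

lemma range_imageι [IsFinite i] : Set.range i.imageι = Set.range i := by
  rw [Scheme.IdealSheafData.range_subschemeι, Scheme.Hom.support_ker,
    i.isClosedMap.isClosed_range.closure_eq]

lemma exists_pushforwardStalk_imageι_ringEquiv :
    ∃ e : PushforwardStalk i (i.imageι η) ≃+* PushforwardStalk i.toImage η,
      ∀ a, e (algebraMap _ _ a) = algebraMap _ _ (i.imageι.stalkMap η a) := by
  have h := exists_pushforwardStalk_ringEquiv i.toImage i.imageι η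
  rwa [i.toImage_imageι] at h

lemma ker_stalkMap_imageι_le_conductor :
    RingHom.ker (i.imageι.stalkMap η).hom ≤
      conductor (Y.presheaf.stalk (i.imageι η)) (PushforwardStalk i (i.imageι η)) := by
  obtain ⟨e, he⟩ := exists_pushforwardStalk_imageι_ringEquiv i η
  refine le_trans (fun a ha ↦ ?_) ker_algebraMap_le_conductor
  rw [RingHom.mem_ker, ← e.map_eq_zero_iff, he, show i.imageι.stalkMap η a = 0 from ha, map_zero]

lemma map_stalkMap_imageι_conductor :
    (conductor (Y.presheaf.stalk (i.imageι η)) (PushforwardStalk i (i.imageι η))).map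
        (i.imageι.stalkMap η).hom =
      conductor (i.image.presheaf.stalk η) (PushforwardStalk i.toImage η) := by
  obtain ⟨e, he⟩ := exists_pushforwardStalk_imageι_ringEquiv i η
  exact map_conductor (i.imageι.stalkMap_surjective η) e he

variable {i} {P : Y}

lemma IsPlainDoublePoint.exists_pairMap_surjective (hP : IsPlainDoublePoint i P) :
    ∃ v : PushforwardStalk i P, Function.Surjective (pairMap (Y.presheaf.stalk P) v) := by
  obtain ⟨η, rfl, hlen⟩ := hP
  have := Module.length_eq_one_iff.1 hlen
  obtain ⟨v, hv⟩ := exists_pairMap_surjective_of_isSimpleModule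
    (A := i.image.presheaf.stalk η) (B := PushforwardStalk i.toImage η)
  obtain ⟨e, he⟩ := exists_pushforwardStalk_imageι_ringEquiv i η
  exact ⟨_, pairMap_symm_surjective (i.imageι.stalkMap_surjective η) e he hv⟩

lemma IsPlainDoublePoint.conductor_ne_top (hP : IsPlainDoublePoint i P) :
    conductor (Y.presheaf.stalk P) (PushforwardStalk i P) ≠ ⊤ := by
  obtain ⟨η, rfl, hlen⟩ := hP
  have := Module.length_eq_one_iff.1 hlen
  have := IsSimpleModule.nontrivial (i.image.presheaf.stalk η) (CokernelStalk i η)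
  intro h
  have htop := map_stalkMap_imageι_conductor i η
  rw [h, Ideal.map_top, eq_comm, conductor, Module.annihilator_eq_top_iff] at htop
  exact not_subsingleton (CokernelStalk i η) htop

lemma IsPlainDoublePoint.mem_range [IsFinite i] (hP : IsPlainDoublePoint i P) :
    P ∈ Set.range i :=
  have ⟨η, hη, _⟩ := hP
  (range_imageι i).le ⟨η, hη⟩

end SchematicImage

section BaseChange

variable {X Y T X' : Scheme.{u}} {i : X ⟶ Y} {j : T ⟶ Y} {k : X' ⟶ X} {i' : X' ⟶ T}
  (H : IsPullback k i' i j) {y : T}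

include H

lemma conductor_ne_top_of_isPullback [IsAffineHom i] [IsClosedImmersion j]
    (hy : conductor (T.presheaf.stalk y) (PushforwardStalk i' y) ≠ ⊤) :
    conductor (Y.presheaf.stalk (j y)) (PushforwardStalk i (j y)) ≠ ⊤ := by
  obtain ⟨ψ, hψ, -, hcomp⟩ := exists_pushforwardStalk_ringHom j H y
  contrapose hy
  rw [conductor_eq_top_iff] at hy ⊢
  refine .of_comp (g := j.stalkMap y) ?_
  have h := hψ.comp hy
  rwa [← RingHom.coe_comp, hcomp] at h

lemma exists_imageι_eq_of_isPullback [IsFinite i] (hy : y ∈ Set.range i') :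
    ∃ η : i.image, i.imageι η = j y := by
  obtain ⟨x, rfl⟩ := hy
  refine (range_imageι i).ge ⟨k x, ?_⟩
  rw [← Scheme.Hom.comp_apply, ← Scheme.Hom.comp_apply, H.w]

end BaseChange

section PlaneCurve

lemma exists_span_range_eq_ker_of_mvPolynomial {X Y : Scheme.{u}} (i : X ⟶ Y) [IsFinite i]
    [JacobsonSpace X] (hCM : IsCohenMacaulayScheme X) (hdim : IsPureDimOne X) {U : Y.Opens}
    (hU : IsAffineOpen U) {K : Type*} [Field K] {τ : MvPolynomial (Fin 2) K →+* Γ(Y, U)}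
    (hτ : Function.Surjective τ) {y : Y} (hy : y ∈ U) {n : ℕ}
    (π : (Fin n → Y.presheaf.stalk y) →ₗ[Y.presheaf.stalk y] PushforwardStalk i y) :
    ∃ r : Fin n → Fin n → Y.presheaf.stalk y,
      Submodule.span _ (Set.range r) = LinearMap.ker π := by
  let p := (hU.primeIdealOf ⟨y, hy⟩).asIdeal
  let := Y.presheaf.algebra_section_stalk ⟨y, hy⟩
  have : IsLocalization.AtPrime (Y.presheaf.stalk y) p := hU.isLocalization_stalk ⟨y, hy⟩
  have : IsNoetherianRing Γ(Y, U) := isNoetherianRing_of_surjective _ _ τ hτ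
  have : IsNoetherianRing (Y.presheaf.stalk y) :=
    IsLocalization.isNoetherianRing p.primeCompl _ inferInstance
  have := finite_pushforwardStalk i y
  by_cases hp : p.IsMaximal
  · exact exists_span_range_eq_ker (spanFinrank_maximalIdeal_le_of_mvPolynomial hτ p)
      (maximalIdeal_notMem_associatedPrimes_pushforwardStalk i hCM hdim hU hy hp) π
  · have := isPrincipalIdealRing_of_spanFinrank_maximalIdeal_le_one
      (Nat.le_of_lt_succ (spanFinrank_maximalIdeal_lt_of_mvPolynomial
        (A := Y.presheaf.stalk y) hτ p hp))
    exact exists_span_range_eq_of_isPrincipalIdealRing _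

variable {R K : Type u} [CommRing R] [Field K] {θ : R →+* K} (hθ : Function.Surjective θ)

include hθ

lemma exists_span_range_eq_ker_fibre {X : Scheme.{u}}
    (i : X ⟶ fibreSpace 2 (Spec.map (CommRingCat.ofHom θ))) [IsFinite i]
    (hCM : IsCohenMacaulayScheme X) (hdim : IsPureDimOne X)
    (P : ↥(fibreSpace 2 (Spec.map (CommRingCat.ofHom θ)))) {n : ℕ}
    (π : (Fin n → (fibreSpace 2 _).presheaf.stalk P) →ₗ[(fibreSpace 2 _).presheaf.stalk P]
      PushforwardStalk i P) :
    ∃ r : Fin n → Fin n → (fibreSpace 2 _).presheaf.stalk P,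
      Submodule.span _ (Set.range r) = LinearMap.ker π := by
  have : IsClosedImmersion (Spec.map (CommRingCat.ofHom θ)) := .spec_of_surjective _ hθ
  have : JacobsonSpace X := LocallyOfFiniteType.jacobsonSpace
    (i ≫ pullback.snd (ProjSpace.toSpec 2 R) (Spec.map (CommRingCat.ofHom θ)))
  obtain ⟨k, hk⟩ := exists_mem_chart 2 R (fibreSpaceMap 2 (Spec.map (CommRingCat.ofHom θ)) P)
  obtain ⟨τ, hτ⟩ := exists_mvPolynomial_surjective_fibre 2 hθ k
  exact exists_span_range_eq_ker_of_mvPolynomial i hCM hdim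
    ((isAffineOpen_chart 2 R k).preimage _) hτ hk π

end PlaneCurve

end CMCurve

end

theorem mainTheorem10_general {R K : Type u} [CommRing R] [IsNoetherianRing R] [Field K]
    {θ : R →+* K} (hθ : Function.Surjective θ) {X : Scheme.{u}} (i : X ⟶ CMCurve.ProjSpace 2 R)
    [IsFinite i] [Flat (i ≫ CMCurve.ProjSpace.toSpec 2 R)]
    (hCM : CMCurve.IsCohenMacaulayScheme
      (pullback i (CMCurve.fibreSpaceMap 2 (Spec.map (CommRingCat.ofHom θ)))))
    (hdim : CMCurve.IsPureDimOne
      (pullback i (CMCurve.fibreSpaceMap 2 (Spec.map (CommRingCat.ofHom θ)))))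
    (P : ↥(CMCurve.fibreSpace 2 (Spec.map (CommRingCat.ofHom θ))))
    (hP : CMCurve.IsPlainDoublePoint
      (CMCurve.fibreMap i (Spec.map (CommRingCat.ofHom θ))) P) :
    ∃ η : ↥i.image, i.imageι η = CMCurve.fibreSpaceMap 2 (Spec.map (CommRingCat.ofHom θ)) P ∧
      ∃ g f s t : (CMCurve.ProjSpace 2 R).presheaf.stalk (i.imageι η),
        (∃ π : (Fin 2 → (CMCurve.ProjSpace 2 R).presheaf.stalk (i.imageι η)) →ₗ[
              (CMCurve.ProjSpace 2 R).presheaf.stalk (i.imageι η)]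
              CMCurve.PushforwardStalk i (i.imageι η),
          Function.Surjective π ∧ LinearMap.ker π = LinearMap.range (!![g, f; s, t]).mulVecLin) ∧
        s ∈ IsLocalRing.maximalIdeal
          ((CMCurve.ProjSpace 2 R).presheaf.stalk (i.imageι η)) ∧
        t ∈ IsLocalRing.maximalIdeal
          ((CMCurve.ProjSpace 2 R).presheaf.stalk (i.imageι η)) ∧
        g ∈ Ideal.span {s, t} ∧ f ∈ Ideal.span {s, t} ∧
        RingHom.ker (i.imageι.stalkMap η).hom ≤ Ideal.span {s, t} ∧
        (Ideal.span {s, t}).map (i.imageι.stalkMap η).hom =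
          Module.annihilator (i.image.presheaf.stalk η) (CMCurve.CokernelStalk i η) := by
  have : IsClosedImmersion (Spec.map (CommRingCat.ofHom θ)) := .spec_of_surjective _ hθ
  have hpb : IsPullback _ _ i (CMCurve.fibreSpaceMap 2 (Spec.map (CommRingCat.ofHom θ))) :=
    .of_hasPullback _ _
  obtain ⟨v', hv'⟩ := hP.exists_pairMap_surjective
  obtain ⟨r', hr'⟩ :=
    CMCurve.exists_span_range_eq_ker_fibre hθ _ hCM hdim P (CMCurve.pairMap _ v')
  have hpres := CMCurve.exists_presentation_of_isPullback (CMCurve.ProjSpace.toSpec 2 R) hpb P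
    (CMCurve.ker_stalkMap_fibreInclusion _ hθ P) hv' hr'
  have hne := CMCurve.conductor_ne_top_of_isPullback hpb hP.conductor_ne_top
  obtain ⟨η, hη⟩ := CMCurve.exists_imageι_eq_of_isPullback hpb hP.mem_range
  rw [← hη] at hpres hne
  obtain ⟨v, hv, r, hr⟩ := hpres
  obtain ⟨g, f, s, t, hker, hg, hf, hst⟩ := CMCurve.exists_matrix_presentation hv hr
  rw [← hst] at hg hf hne
  exact ⟨η, hη, g, f, s, t, ⟨_, hv, hker⟩,
    IsLocalRing.le_maximalIdeal hne (Ideal.subset_span (by simp)),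
    IsLocalRing.le_maximalIdeal hne (Ideal.subset_span (by simp)), hg, hf,
    hst ▸ CMCurve.ker_stalkMap_imageι_le_conductor i η,
    hst ▸ CMCurve.map_stalkMap_imageι_conductor i η⟩

theorem mainTheorem10 {R : Type u} [CommRing R] [IsLocalRing R] [IsNoetherianRing R]
    [IsAlgClosed (IsLocalRing.ResidueField R)] {X : Scheme.{u}}
    (i : X ⟶ CMCurve.ProjSpace 2 R) (hi : CMCurve.IsCMFamily i)
    (P : ↥(CMCurve.fibreSpace 2 (CMCurve.closedPt R)))
    (hP : CMCurve.IsPlainDoublePoint (CMCurve.fibreMap i (CMCurve.closedPt R)) P) :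
    ∃ η : ↥i.image, i.imageι η = CMCurve.fibreSpaceMap 2 (CMCurve.closedPt R) P ∧
      ∃ g f s t : (CMCurve.ProjSpace 2 R).presheaf.stalk (i.imageι η),
        (∃ π : (Fin 2 → (CMCurve.ProjSpace 2 R).presheaf.stalk (i.imageι η)) →ₗ[
              (CMCurve.ProjSpace 2 R).presheaf.stalk (i.imageι η)]
              CMCurve.PushforwardStalk i (i.imageι η),
          Function.Surjective π ∧ LinearMap.ker π = LinearMap.range (!![g, f; s, t]).mulVecLin) ∧
        s ∈ IsLocalRing.maximalIdeal
          ((CMCurve.ProjSpace 2 R).presheaf.stalk (i.imageι η)) ∧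
        t ∈ IsLocalRing.maximalIdeal
          ((CMCurve.ProjSpace 2 R).presheaf.stalk (i.imageι η)) ∧
        g ∈ Ideal.span {s, t} ∧ f ∈ Ideal.span {s, t} ∧
        RingHom.ker (i.imageι.stalkMap η).hom ≤ Ideal.span {s, t} ∧
        (Ideal.span {s, t}).map (i.imageι.stalkMap η).hom =
          Module.annihilator (i.image.presheaf.stalk η) (CMCurve.CokernelStalk i η) := by
  have hfibre := hi.geometricFibre (IsLocalRing.ResidueField R) (CMCurve.closedPt R)
  have := hi.finite
  have := hi.flat
  exact mainTheorem10_general IsLocalRing.residue_surjective i hfibre.cohenMacaulay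
    hfibre.pureDimOne P hP
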